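/- **Setting.** Let $F$ be a fixed graph and $r\ge 2$ a fixed integer. The vertex Achlioptas game with parameters $F$ and $r$ is played on the binomial random graph $G(n,p)$ with vertices $v_1,\dots,v_n$, where $r\mid n$ and $p=p(n)\in[0,1]$; the graph is initially hidden. In step $i=1,\dots,n/r$ the vertices $v_{(i-1)r+1},\dots,v_{ir}$ are revealed, together with all edges induced by $v_1,\dots,v_{ir}$, and the player must immediately select exactly one of the $r$ new vertices. She loses if the graph induced by the selected vertices contains a copy of $F$. A function $p_0=p_0(F,r,n)$ is a *threshold* of the game if (i) for every $p(n)\ll p_0$ there is a strategy with which the player a.a.s. does not lose, and (ii) for every $p(n)\gg p_0$ the player a.a.s. loses, regardless of her strategy. Here $f\ll g$ (equivalently $g\gg f$) means $f=o(g)$, and all asymptotics are for $n\to\infty$ along the multiples of $r$. **The parameter.** For a finite graph $H_1$ with $h\ge1$ vertices and an ordering $\pi=(u_1,\dots,u_h)$ of its vertices, and for subgraphs $H_2,\dots,H_h$ with $u_i\in V(H_i)$ and $H_i\subseteq H_1\setminus\{u_1,\dots,u_{i-1}\}$ for $2\le i\le h$, let $$c_1:=r,\qquad c_i:=(r-1)\sum_{j=1}^{i-1}c_j\,\mathbf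 1_{\{u_i\in V(H_j)\}}\quad(2\le i\le h),$$ and put $$d^{r*}(H_1,\pi):=\max_{H_2,\dots,H_h}\frac{\sum_{i=1}^h c_i\,e(H_i)}{1+\sum_{i=1}^h c_i\,(v(H_i)-1)},$$ the maximum being over all such sequences $H_2,\dots,H_h$. For a graph $F$ with at least one edge let $$m^{r*}(F):=\min_{\pi}\ \max_{H_1\subseteq F}\ d^{r*}(H_1,\pi|_{H_1}),$$ where $\pi$ ranges over all orderings of $V(F)$, $H_1$ over all (not necessarily induced) subgraphs of $F$ with at least one vertex, and $\pi|_{H_1}$ is the induced ordering. **Theorem.** Let $F$ be a fixed finite graph with at least one edge, and let $r\ge 2$ be a fixed integer. Then the threshold of the vertex Achlioptas game with parameters $F$ and $r$ is $$p_0(F,r,n)=n^{-1/m^{r*}(F)}.$$ In particular, if $p(n)\gg n^{-1/m^{r*}(F)}$, then the player a.a.s. loses the vertex Achlioptas game with parameters $F$ and $r$, regardless of her strategy. -/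

import Mathlib

open Filter Topology Asymptotics

noncomputable section

namespace VertexAchlioptas

/-! ### The parameter `m^{r*}(F)` -/

/-- An ordering `π = (u_1, …, u_v)` of the vertex set: `π u` is the position of `u` (counted
from `0`). Smaller positions belong to younger vertices (those that appear later in the game).
A subgraph carries the induced order, i.e. its vertices are compared through `π`. -/
abbrev VertexOrdering (V : Type*) [Fintype V] : Type _ := V ≃ Fin (Fintype.card V)

variable {V : Type*} [Fintype V] {F : SimpleGraph V}

/-- `u` is the youngest vertex `u_1` of `(H, π|_H)`. -/
def IsYoungest (π : VertexOrdering V) (H : F.Subgraph) (u : V) : Prop :=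
  u ∈ H.verts ∧ ∀ w ∈ H.verts, π u ≤ π w

/-- The sequences `(H_1, H_2, …, H_h)` over which one maximizes for the ordered graph
`(H₁, π|_{H₁})`, `π|_{H₁} = (u_1, …, u_h)`. The member `H_i` is written `Hs u_i`, i.e. the sequence
is indexed by the vertices of `H₁` (the values of `Hs` outside `H₁` are never used). The
requirements are that the first member is `H₁` itself, and that `H_i ⊆ H₁ ∖ {u_1, …, u_{i-1}}` and
`u_i ∈ H_i`; the last two hold automatically for `i = 1`. -/
structure IsSubgraphSequence (π : VertexOrdering V) (H₁ : F.Subgraph) (Hs : V → F.Subgraph) :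
    Prop where
  first : ∀ u, IsYoungest π H₁ u → Hs u = H₁
  subgraph : ∀ u ∈ H₁.verts, Hs u ≤ H₁
  avoids : ∀ u ∈ H₁.verts, ∀ w ∈ (Hs u).verts, π u ≤ π w
  mem : ∀ u ∈ H₁.verts, u ∈ (Hs u).verts

open Classical in
/-- The coefficients `c_i`, indexed by the vertices `u_i` of `H₁`: `c_1 = r`, and
`c_i = (r - 1) * ∑_{j < i} c_j * 1[u_i ∈ H_j]` for `i ≥ 2`. -/
def coeff (r : ℕ) (π : VertexOrdering V) (H₁ : F.Subgraph) (Hs : V → F.Subgraph) (u : V) : ℝ :=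
  if IsYoungest π H₁ u then (r : ℝ)
  else ((r : ℝ) - 1) *
    ∑ w : {w : V // w ∈ H₁.verts ∧ π w < π u ∧ u ∈ (Hs w).verts}, coeff r π H₁ Hs w.1
termination_by (π u).val
decreasing_by exact w.2.2.1

open Classical in
/-- `(∑ c_i e(H_i)) / (1 + ∑ c_i (v(H_i) - 1))`, the sums being over the vertices `u_i` of `H₁`. -/
def densityRatio (r : ℕ) (π : VertexOrdering V) (H₁ : F.Subgraph) (Hs : V → F.Subgraph) : ℝ :=
  (∑ u : {u : V // u ∈ H₁.verts}, coeff r π H₁ Hs u.1 * ((Hs u.1).edgeSet.ncard : ℝ)) /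
    (1 + ∑ u : {u : V // u ∈ H₁.verts}, coeff r π H₁ Hs u.1 * (((Hs u.1).verts.ncard : ℝ) - 1))

/-- `d^{r*}(H₁, π|_{H₁})`. The supremum is a maximum: there are finitely many sequences, and at
least one. For `H₁` without edges the value is `0`. -/
def dStar (r : ℕ) (π : VertexOrdering V) (H₁ : F.Subgraph) : ℝ :=
  ⨆ Hs : {Hs : V → F.Subgraph // IsSubgraphSequence π H₁ Hs}, densityRatio r π H₁ Hs.1

/-- `m^{r*}(F) = min_π max_{H₁ ⊆ F} d^{r*}(H₁, π|_{H₁})`; again both index sets are finite and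
nonempty. -/
def mStar (r : ℕ) (F : SimpleGraph V) : ℝ :=
  ⨅ π : VertexOrdering V, ⨆ H₁ : F.Subgraph, dStar r π H₁

/-! ### The vertex Achlioptas game

A game with `N` steps is played on `n = N * r` vertices. The vertices are the pairs `(i, j)` in
`Fin N × Fin r`; in step `i` the `r` vertices `(i, 0), …, (i, r - 1)` are revealed. -/

/-- The vertices that have been revealed once the `i`-th `r`-set has been presented. -/
def revealed {N : ℕ} (r : ℕ) (i : Fin N) : Set (Fin N × Fin r) := {v | v.1 ≤ i}

/-- A strategy: in step `i` the player sees the graph induced by all the vertices revealed so far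
(the current `r`-set included), and selects one of the `r` new vertices. Her earlier choices are
themselves determined by the graph that she sees. -/
def Strategy (N r : ℕ) : Type :=
  (i : Fin N) → SimpleGraph (revealed r i) → Fin r

/-- The set of vertices selected in the whole game if the hidden graph is `G`. -/
def selected {N r : ℕ} (σ : Strategy N r) (G : SimpleGraph (Fin N × Fin r)) :
    Set (Fin N × Fin r) :=
  Set.range fun i : Fin N => (i, σ i (G.induce (revealed r i)))

/-- The player loses if the selected vertices span a (not necessarily induced) copy of `F`. -/
def Loses {N r : ℕ} (F : SimpleGraph V) (σ : Strategy N r)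
    (G : SimpleGraph (Fin N × Fin r)) : Prop :=
  F.IsContained (G.induce (selected σ G))

/-- The probability that `σ` loses when the hidden graph is the binomial random graph `G(n, p)`,
`n = N * r`. -/
def probLoses {N r : ℕ} (F : SimpleGraph V) (σ : Strategy N r) (p : unitInterval) : ENNReal :=
  SimpleGraph.binomialRandom (Fin N × Fin r) p {G | Loses F σ G}

/-- The probability that `σ` survives, i.e. handles all `n = N * r` vertices without creating a
copy of `F`. -/
def probSurvives {N r : ℕ} (F : SimpleGraph V) (σ : Strategy N r) (p : unitInterval) : ENNReal :=
  SimpleGraph.binomialRandom (Fin N × Fin r) p {G | ¬ Loses F σ G}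

/-- `p₀` is a threshold function of the vertex Achlioptas game with parameters `F` and `r`. All
asymptotics are for `n → ∞` along the multiples `n = N * r` of `r`. -/
structure IsThreshold (F : SimpleGraph V) (r : ℕ) (p₀ : ℕ → ℝ) : Prop where
  /-- If `p ≪ p₀`, some strategy a.a.s. survives. -/
  survives : ∀ p : ℕ → unitInterval,
    (fun N : ℕ => (p (N * r) : ℝ)) =o[atTop] (fun N : ℕ => p₀ (N * r)) →
    ∃ σ : (N : ℕ) → Strategy N r,
      Tendsto (fun N : ℕ => probSurvives F (σ N) (p (N * r))) atTop (𝓝 1)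
  /-- If `p ≫ p₀`, every strategy a.a.s. loses. -/
  loses : ∀ p : ℕ → unitInterval,
    (fun N : ℕ => p₀ (N * r)) =o[atTop] (fun N : ℕ => (p (N * r) : ℝ)) →
    ∀ σ : (N : ℕ) → Strategy N r,
      Tendsto (fun N : ℕ => probLoses F (σ N) (p (N * r))) atTop (𝓝 1)

end VertexAchlioptas

end

/-!
Both halves compare the game with weighted sets of rounds. Write `m = mStar r F` and `θ = 1 / m`;
at `p = n ^ (-θ)`, a configuration that spans `b` rounds and `e` edges has about
`n ^ (b - θ * e)` copies in the hidden graph.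

*Survival.* If `p ≪ n ^ (-1 / m)`, then a.a.s. every set of boundedly many rounds spans fewer than
`m` edges per round (`binomialRandom_real_not_isSparse_le`), and on a hidden graph of this kind a
deterministic strategy survives (`not_loses_of_isSparse`). The player measures the danger of a
vertex `v` by the least value of `b - θ' * e` over the sets of earlier rounds, the edges at `v`
included, and selects a vertex of least danger; `θ'` is slightly smaller than `θ`, which bounds the
size of all relevant configurations. Suppose that she completes a copy of `F`. The order in which
it was built determines an ordering `π`, and by the definition of `m` there is a sequence
`H₁, H₂, …` of ratio at least `m`. Whenever a vertex of the copy was selected, its `r - 1`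
competitors were at least as dangerous, so the configurations that they see can be glued to the
copy. Overlaps between these only help, because sparse sets have nonnegative excess
(`exists_exploration`). This bounds the danger of the vertex in the role of `u` by that of the
members of the sequence (`minExcess_selected_le`), the recursion for the coefficients `c_i` adds up
these bounds (`sum_coeff_mul_eq`), and the last round with all that its `r` vertices see would be
a set of rounds that is too dense.

*Losing.* Fix an optimal `π`. Consider the `r`-ary tree of rounds in which every vertex of a round
completes, in the order `π`, a copy of the next larger part of `F`, whatever was selected in the
rounds below; if the tree occurs in the hidden graph, the player loses. Which edges are needed
depends on her selections, but the edges that go down from a round are determined by the past and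
fresh, so a given placement of the tree succeeds with probability exactly `p ^ e`, and placements
that agree nowhere are independent (`binomialRandom_real_adaptive`). For overlapping placements a
union bound over the boundedly many selected indices suffices, since every set `B` of rounds of
the tree spans at most `m * |B|` edges (`sum_treeDegree_le`), and the second moment method applies
(`binomialRandom_real_not_loses_le`). The bound on the edges follows from the definition of `m`:
inside the copy of a part of `F`, the best choice for `B` below a vertex in the role of `u_i` is an
optimal `H_i`. Vertex sets optimal for different `u_i` can be uncrossed
(`subset_of_maximal_threat`), so that they form a sequence of the kind over which one maximizes.
-/

noncomputable section

namespace VertexAchlioptas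

/-! ### Independence of the edges of the binomial random graph -/

section RandomGraph

open Classical SimpleGraph

variable {U : Type*} [Fintype U] (p : unitInterval)

lemma binomialRandom_real_eq_sum_filter (A : Set (SimpleGraph U)) :
    (binomialRandom U p).real A = ∑ G with G ∈ A, (binomialRandom U p).real {G} := by
  have : A = ⋃ G ∈ Finset.univ.filter (· ∈ A), ({G} : Set (SimpleGraph U)) := by ext; simp
  conv_lhs => rw [this]
  rw [MeasureTheory.measureReal_biUnion_finset]
  · intro a _ b _ hab
    simpa [Function.onFun] using hab
  · intro b _
    rw [show ({b} : Set (SimpleGraph U)) = edgeSet ⁻¹' {b.edgeSet} by ext; simp]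
    exact measurable_edgeSet (measurableSet_singleton _)

lemma binomialRandom_real_eq_sum (A : Set (SimpleGraph U)) :
    (binomialRandom U p).real A =
      ∑ G : SimpleGraph U, if G ∈ A then (binomialRandom U p).real {G} else 0 := by
  rw [binomialRandom_real_eq_sum_filter, Finset.sum_filter]

lemma binomialRandom_real_singleton (G : SimpleGraph U) :
    (binomialRandom U p).real {G} = (p : ℝ) ^ G.edgeSet.ncard *
      (1 - p : ℝ) ^ ((Fintype.card U).choose 2 - G.edgeSet.ncard) := by
  rw [MeasureTheory.measureReal_def, binomialRandom_singleton]
  simp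

lemma binomialRandom_real_eq_sum_fiber {β : Type*} [Fintype β] (f : SimpleGraph U → β)
    (A : Set (SimpleGraph U)) :
    (binomialRandom U p).real A = ∑ b, (binomialRandom U p).real (A ∩ {G | f G = b}) := by
  simp_rw [binomialRandom_real_eq_sum p (_ ∩ _)]
  rw [binomialRandom_real_eq_sum, Finset.sum_comm]
  refine Finset.sum_congr rfl fun G _ => ?_
  by_cases h : G ∈ A <;> simp [h]

/-- The event `A` does not depend on the edges in `D`. -/
def IndepOfEdges {U : Type*} (A : Set (SimpleGraph U)) (D : Set (Sym2 U)) : Prop :=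
  ∀ G G' : SimpleGraph U, (∀ e ∉ D, e ∈ G.edgeSet ↔ e ∈ G'.edgeSet) → (G ∈ A ↔ G' ∈ A)

lemma IndepOfEdges.mono {U : Type*} {A : Set (SimpleGraph U)} {D D' : Set (Sym2 U)}
    (h : IndepOfEdges A D) (hD : D' ⊆ D) : IndepOfEdges A D' :=
  fun G G' hG => h G G' fun e he => hG e fun he' => he (hD he')

/-- Adding the edge `e` maps the graphs of `A` without `e` onto those with `e`, and multiplies
their probabilities by `p / (1 - p)`. -/
lemma binomialRandom_real_inter_edge (A : Set (SimpleGraph U)) (e : Sym2 U) (he : ¬ e.IsDiag)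
    (hA : IndepOfEdges A {e}) :
    (binomialRandom U p).real (A ∩ {G | e ∈ G.edgeSet}) = p * (binomialRandom U p).real A := by
  have key : (1 - p : ℝ) * (binomialRandom U p).real (A ∩ {G | e ∈ G.edgeSet}) =
      p * (binomialRandom U p).real (A ∩ {G | e ∉ G.edgeSet}) := by
    rw [binomialRandom_real_eq_sum_filter, binomialRandom_real_eq_sum_filter, Finset.mul_sum,
      Finset.mul_sum]
    have hadd : ∀ G : SimpleGraph U, (G ⊔ fromEdgeSet {e}).edgeSet = insert e G.edgeSet := by
      intro G
      rw [edgeSet_sup, edgeSet_fromEdgeSet, Set.union_comm]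
      ext x; simp only [Set.mem_union, Set.mem_sdiff, Set.mem_singleton_iff, Set.mem_insert_iff]
      constructor
      · tauto
      · rintro (rfl | h)
        · exact Or.inl ⟨rfl, he⟩
        · exact Or.inr h
    refine Finset.sum_bij' (fun G _ => G.deleteEdges {e}) (fun G _ => G ⊔ fromEdgeSet {e})
      ?_ ?_ ?_ ?_ ?_
    · intro G hG
      simp only [Finset.mem_filter, Finset.mem_univ, true_and, Set.mem_inter_iff,
        Set.mem_ofPred_eq] at hG ⊢
      refine ⟨(hA G _ fun x hx => ?_).1 hG.1, ?_⟩
      · simp [edgeSet_deleteEdges] at hx ⊢; tauto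
      · simp [edgeSet_deleteEdges]
    · intro G hG
      simp only [Finset.mem_filter, Finset.mem_univ, true_and, Set.mem_inter_iff,
        Set.mem_ofPred_eq] at hG ⊢
      rw [hadd]
      refine ⟨(hA G _ fun x hx => ?_).1 hG.1, Set.mem_insert _ _⟩
      rw [hadd]
      simp only [Set.mem_singleton_iff] at hx
      simp [hx]
    · intro G hG
      simp only [Finset.mem_filter, Finset.mem_univ, true_and, Set.mem_inter_iff,
        Set.mem_ofPred_eq] at hG
      apply edgeSet_injective
      rw [hadd, edgeSet_deleteEdges]
      simp [hG.2]
    · intro G hG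
      simp only [Finset.mem_filter, Finset.mem_univ, true_and, Set.mem_inter_iff,
        Set.mem_ofPred_eq] at hG
      apply edgeSet_injective
      rw [edgeSet_deleteEdges, hadd]
      simp [hG.2]
    · intro G hG
      simp only [Finset.mem_filter, Finset.mem_univ, true_and, Set.mem_inter_iff,
        Set.mem_ofPred_eq] at hG
      rw [binomialRandom_real_singleton, binomialRandom_real_singleton]
      have h2 : (G.deleteEdges {e}).edgeSet.ncard + 1 = G.edgeSet.ncard := by
        rw [edgeSet_deleteEdges]
        exact Set.ncard_sdiff_singleton_add_one hG.2 (Set.toFinite _)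
      have h4 : G.edgeSet.ncard ≤ (Fintype.card U).choose 2 := by
        rw [← coe_edgeFinset, Set.ncard_coe_finset]
        exact card_edgeFinset_le_card_choose_two
      obtain ⟨k, hk⟩ : ∃ k, (G.deleteEdges {e}).edgeSet.ncard = k := ⟨_, rfl⟩
      rw [hk] at h2
      have h5 : (Fintype.card U).choose 2 - k = ((Fintype.card U).choose 2 - (k + 1)) + 1 := by
        omega
      rw [hk, ← h2, h5]
      ring
  have hsum : (binomialRandom U p).real A = (binomialRandom U p).real (A ∩ {G | e ∈ G.edgeSet}) +
      (binomialRandom U p).real (A ∩ {G | e ∉ G.edgeSet}) := by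
    rw [binomialRandom_real_eq_sum, binomialRandom_real_eq_sum, binomialRandom_real_eq_sum,
      ← Finset.sum_add_distrib]
    refine Finset.sum_congr rfl fun G _ => ?_
    by_cases h : G ∈ A <;> by_cases h' : e ∈ G.edgeSet <;> simp [h, h']
  rw [hsum]
  linear_combination key

lemma binomialRandom_real_inter_edges (A : Set (SimpleGraph U)) (D : Finset (Sym2 U))
    (hD : ∀ e ∈ D, ¬ e.IsDiag) (hA : IndepOfEdges A D) :
    (binomialRandom U p).real (A ∩ {G | ∀ e ∈ D, e ∈ G.edgeSet}) =
      p ^ D.card * (binomialRandom U p).real A := by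
  induction D using Finset.induction_on with
  | empty => simp
  | insert e D he ih =>
    have h1 : A ∩ {G | ∀ x ∈ insert e D, x ∈ G.edgeSet} =
        (A ∩ {G | ∀ x ∈ D, x ∈ G.edgeSet}) ∩ {G | e ∈ G.edgeSet} := by
      ext G; simp; tauto
    rw [h1, binomialRandom_real_inter_edge p _ e (hD e (by simp)), ih,
      Finset.card_insert_of_notMem he]
    · ring
    · exact fun x hx => hD x (by simp [hx])
    · exact hA.mono (by simp)
    · intro G G' hG
      have h2 := hA G G' (fun x hx => hG x (by simp at hx ⊢; tauto))
      have h3 : ∀ x ∈ D, x ∈ G.edgeSet ↔ x ∈ G'.edgeSet :=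
        fun x hx => hG x (by rintro rfl; exact he hx)
      simp only [Set.mem_inter_iff, Set.mem_ofPred_eq, h2]
      exact and_congr_right fun _ => forall₂_congr h3

/-- A set of ordered pairs of vertices, each of which has its later vertex first. -/
def Descending (τ : U → ℕ) (D : Finset (U × U)) : Prop := ∀ e ∈ D, τ e.2 < τ e.1

lemma binomialRandom_real_inter_pairs {τ : U → ℕ} {D : Finset (U × U)} (hD : Descending τ D)
    (A : Set (SimpleGraph U)) (hA : IndepOfEdges A {x | ∃ e ∈ D, x = s(e.1, e.2)}) :
    (binomialRandom U p).real (A ∩ {G | ∀ e ∈ D, G.Adj e.1 e.2}) =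
      p ^ D.card * (binomialRandom U p).real A := by
  have hinj : Set.InjOn (fun e : U × U => s(e.1, e.2)) D := by
    rintro ⟨a, b⟩ h ⟨c, d⟩ h' heq
    have h1 := hD _ h
    have h2 := hD _ h'
    simp only [Sym2.eq_iff] at heq h1 h2
    rcases heq with ⟨rfl, rfl⟩ | ⟨rfl, rfl⟩
    · rfl
    · omega
  have := binomialRandom_real_inter_edges p A (D.image fun e => s(e.1, e.2)) ?_ ?_
  · rw [Finset.card_image_of_injOn hinj] at this
    rw [← this]
    congr 1
    ext G
    simp only [Set.mem_inter_iff, Set.mem_ofPred_eq, Finset.forall_mem_image, mem_edgeSet]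
  · simp only [Finset.forall_mem_image]
    intro e he
    have := hD e he
    simp only [Sym2.mk_isDiag_iff]
    intro h
    rw [h] at this
    exact lt_irrefl _ this
  · refine hA.mono fun x hx => ?_
    simp only [Finset.coe_image, Set.mem_image, Finset.mem_coe] at hx
    obtain ⟨e, he, rfl⟩ := hx
    exact ⟨e, he, rfl⟩

lemma binomialRandom_real_pairs {τ : U → ℕ} {D : Finset (U × U)} (hD : Descending τ D) :
    (binomialRandom U p).real {G | ∀ e ∈ D, G.Adj e.1 e.2} = p ^ D.card := by
  have := binomialRandom_real_inter_pairs p hD Set.univ (fun _ _ _ => Iff.rfl)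
  simpa using this

/-- Edges that are queried adaptively: which `d t` edges are queried at time `t` may depend on the
graph spanned by the vertices of earlier times, and each of these edges joins a vertex of time `t`
to an earlier one. All queries of times `t < k` succeed with probability `p ^ ∑ d t`. -/
lemma binomialRandom_real_adaptive (τ : U → ℕ) (D : ℕ → SimpleGraph U → Finset (U × U)) (d : ℕ → ℕ)
    (hτ : ∀ t G, ∀ e ∈ D t G, τ e.1 = t ∧ τ e.2 < t) (hd : ∀ t G, (D t G).card = d t)
    (hdep : ∀ t G G', (∀ a b, τ a < t → τ b < t → (G.Adj a b ↔ G'.Adj a b)) → D t G = D t G')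
    (k : ℕ) :
    (binomialRandom U p).real {G | ∀ t < k, ∀ e ∈ D t G, G.Adj e.1 e.2} =
      p ^ (∑ t ∈ Finset.range k, d t) := by
  induction k with
  | zero => simp
  | succ k ih =>
    have hsplit : {G | ∀ t < k + 1, ∀ e ∈ D t G, G.Adj e.1 e.2} =
        {G | ∀ t < k, ∀ e ∈ D t G, G.Adj e.1 e.2} ∩ {G | ∀ e ∈ D k G, G.Adj e.1 e.2} := by
      ext G
      simp only [Set.mem_ofPred_eq, Set.mem_inter_iff, Nat.lt_succ_iff_lt_or_eq]
      constructor
      · exact fun h => ⟨fun t ht => h t (Or.inl ht), h k (Or.inr rfl)⟩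
      · rintro ⟨h1, h2⟩ t (ht | rfl)
        · exact h1 t ht
        · exact h2
    rw [hsplit, binomialRandom_real_eq_sum_fiber p (D k), Finset.sum_range_succ, pow_add, ← ih,
      binomialRandom_real_eq_sum_fiber p (D k) {G | ∀ t < k, ∀ e ∈ D t G, G.Adj e.1 e.2},
      Finset.sum_mul]
    refine Finset.sum_congr rfl fun S _ => ?_
    -- Given that the queries of time `k` are `S`, they are fresh edges.
    by_cases hS : ∃ G, D k G = S
    swap
    · push Not at hS
      have : {G | D k G = S} = ∅ := by ext G; simp [hS G]
      simp [this]
    obtain ⟨G₀, rfl⟩ := hS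
    have h1 : {G | ∀ t < k, ∀ e ∈ D t G, G.Adj e.1 e.2} ∩ {G | ∀ e ∈ D k G, G.Adj e.1 e.2} ∩
        {G | D k G = D k G₀} =
        ({G | ∀ t < k, ∀ e ∈ D t G, G.Adj e.1 e.2} ∩ {G | D k G = D k G₀}) ∩
          {G | ∀ e ∈ D k G₀, G.Adj e.1 e.2} := by
      ext G
      simp only [Set.mem_inter_iff, Set.mem_ofPred_eq]
      constructor
      · rintro ⟨⟨h1, h2⟩, h3⟩
        exact ⟨⟨h1, h3⟩, h3 ▸ h2⟩
      · rintro ⟨⟨h1, h3⟩, h2⟩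
        exact ⟨⟨h1, h3 ▸ h2⟩, h3⟩
    rw [h1, binomialRandom_real_inter_pairs p (τ := τ), hd, mul_comm]
    · intro e he
      have := hτ _ _ e he
      omega
    · intro G G' hG
      have hadj : ∀ a b, τ a < k → τ b < k → (G.Adj a b ↔ G'.Adj a b) := by
        intro a b ha hb
        have := hG s(a, b) ?_
        · simpa using this
        · rintro ⟨e, he, heq⟩
          have := (hτ _ _ e he).1
          rw [Sym2.eq_iff] at heq
          rcases heq with ⟨rfl, rfl⟩ | ⟨rfl, rfl⟩ <;> omega
      have hD : ∀ t ≤ k, D t G = D t G' := fun t ht =>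
        hdep t G G' fun a b ha hb => hadj a b (by omega) (by omega)
      simp only [Set.mem_inter_iff, Set.mem_ofPred_eq, hD k le_rfl]
      refine and_congr_left fun _ => forall₂_congr fun t ht => ?_
      rw [hD t ht.le]
      refine forall₂_congr fun e he => ?_
      have := hτ _ _ e he
      exact hadj _ _ (by omega) (by omega)

/-- Chebyshev's inequality for the event that a counting variable vanishes. -/
lemma binomialRandom_real_forall_not_le {Ψ : Type*} [Fintype Ψ] (E : Ψ → Set (SimpleGraph U))
    {μ : ℝ} (hμ : ∑ ψ, (binomialRandom U p).real (E ψ) = μ) :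
    μ ^ 2 * (binomialRandom U p).real {G | ∀ ψ, G ∉ E ψ} ≤
      ∑ ψ, ∑ ψ', (binomialRandom U p).real (E ψ ∩ E ψ') - μ ^ 2 := by
  set w : SimpleGraph U → ℝ := fun G => (binomialRandom U p).real {G} with hw
  set X : SimpleGraph U → ℝ := fun G => ∑ ψ, if G ∈ E ψ then 1 else 0 with hX
  have hw0 : ∀ G, 0 ≤ w G := fun G => MeasureTheory.measureReal_nonneg
  have hw1 : ∑ G, w G = 1 := by
    have := binomialRandom_real_eq_sum p (Set.univ : Set (SimpleGraph U))
    simpa [hw] using this.symm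
  have hEX : ∑ G, w G * X G = μ := by
    rw [← hμ]
    simp_rw [binomialRandom_real_eq_sum p (E _)]
    rw [Finset.sum_comm]
    refine Finset.sum_congr rfl fun G _ => ?_
    simp only [hX, hw]
    rw [Finset.mul_sum]
    exact Finset.sum_congr rfl fun ψ _ => by simp
  have hEX2 : ∑ G, w G * X G ^ 2 = ∑ ψ, ∑ ψ', (binomialRandom U p).real (E ψ ∩ E ψ') := by
    simp_rw [binomialRandom_real_eq_sum p (E _ ∩ E _)]
    simp_rw [Finset.sum_comm (t := (Finset.univ : Finset (SimpleGraph U)))]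
    refine Finset.sum_congr rfl fun G _ => ?_
    simp only [hX, hw, pow_two]
    rw [Finset.sum_mul_sum, Finset.mul_sum]
    refine Finset.sum_congr rfl fun ψ _ => ?_
    rw [Finset.mul_sum]
    refine Finset.sum_congr rfl fun ψ' _ => ?_
    by_cases h : G ∈ E ψ <;> by_cases h' : G ∈ E ψ' <;> simp [h, h']
  have hvar : ∑ G, w G * (X G - μ) ^ 2 =
      ∑ ψ, ∑ ψ', (binomialRandom U p).real (E ψ ∩ E ψ') - μ ^ 2 := by
    have : ∑ G, w G * (X G - μ) ^ 2 =
        ∑ G, w G * X G ^ 2 - 2 * μ * ∑ G, w G * X G + μ ^ 2 * ∑ G, w G := by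
      rw [Finset.mul_sum, Finset.mul_sum, ← Finset.sum_sub_distrib, ← Finset.sum_add_distrib]
      exact Finset.sum_congr rfl fun G _ => by ring
    rw [this, hEX, hEX2, hw1]; ring
  rw [← hvar, binomialRandom_real_eq_sum, Finset.mul_sum]
  refine Finset.sum_le_sum fun G _ => ?_
  by_cases h : G ∈ {G | ∀ ψ, G ∉ E ψ}
  · have : X G = 0 := by
      simp only [hX]
      exact Finset.sum_eq_zero fun ψ _ => by simp [show G ∉ E ψ from h ψ]
    rw [if_pos h, this]
    apply le_of_eq; ring
  · rw [if_neg h, mul_zero]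
    exact mul_nonneg (hw0 G) (sq_nonneg _)

end RandomGraph

/-! ### Sparsity of sets of rounds -/

section Exploration

open Classical

variable {N r : ℕ} (G : SimpleGraph (Fin N × Fin r))

/-- The vertices that are revealed in the rounds of `X`. -/
def verticesIn (X : Finset (Fin N)) : Finset (Fin N × Fin r) := Finset.univ.filter fun v => v.1 ∈ X

@[simp] lemma mem_verticesIn {X : Finset (Fin N)} {v : Fin N × Fin r} :
    v ∈ verticesIn X ↔ v.1 ∈ X := by simp [verticesIn]

/-- The edges of `G` that join a vertex of `A` to a vertex of an earlier round in `X`, as ordered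
pairs with the later vertex first. -/
def downEdges (A : Finset (Fin N × Fin r)) (X : Finset (Fin N)) :
    Finset ((Fin N × Fin r) × (Fin N × Fin r)) :=
  Finset.univ.filter fun e => e.1 ∈ A ∧ e.2.1 ∈ X ∧ e.2.1 < e.1.1 ∧ G.Adj e.1 e.2

lemma mem_downEdges {A : Finset (Fin N × Fin r)} {X : Finset (Fin N)}
    {e : (Fin N × Fin r) × (Fin N × Fin r)} :
    e ∈ downEdges G A X ↔ e.1 ∈ A ∧ e.2.1 ∈ X ∧ e.2.1 < e.1.1 ∧ G.Adj e.1 e.2 := by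
  simp [downEdges]

/-- The number of edges of `G` between different rounds of `X`. -/
def edgesIn (X : Finset (Fin N)) : ℕ := (downEdges G (verticesIn X) X).card

/-- The excess of a set `X` of rounds seen from a vertex `v` of a later round: the number of rounds
minus `θ` times the number of edges spanned by `X` and `v`. If `p = n ^ (-θ)`, the expected number
of configurations of this kind seen by a given `v` is of order `n` to this power. Edges inside a
round are not counted. -/
def rootedExcess (θ : ℝ) (v : Fin N × Fin r) (X : Finset (Fin N)) : ℝ :=
  X.card - θ * (edgesIn G X + (downEdges G {v} X).card)

lemma rootedExcess_empty (θ : ℝ) (v : Fin N × Fin r) : rootedExcess G θ v ∅ = 0 := by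
  simp [rootedExcess, edgesIn, downEdges]

/-- Adding to `C` a set `X` of rounds seen by one vertex `v` of `C` whose downward edges have not
been counted so far. The rounds common to `X` and `C` only help, provided that they are sparse. -/
lemma card_sub_edges_union_le {θ : ℝ} (hθ : 0 ≤ θ) {C X : Finset (Fin N)} {v : Fin N × Fin r}
    {A A' : Finset (Fin N × Fin r)} (hX : ∀ t ∈ X, t < v.1) (hA : v ∉ A)
    (hA' : A ⊆ A') (hvA' : v ∈ A') (hXA' : verticesIn X ⊆ A')
    (hAC : ∀ a ∈ A, a.1 ∈ C)
    (hsparse : θ * edgesIn G (X ∩ C) ≤ (X ∩ C).card) :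
    ((C ∪ X).card : ℝ) - θ * (downEdges G A' (C ∪ X)).card ≤
      C.card - θ * (downEdges G A C).card + rootedExcess G θ v X := by
  have hcard : ((C ∪ X).card : ℝ) + (X ∩ C).card = C.card + X.card := by
    rw [Finset.inter_comm]
    exact_mod_cast Finset.card_union_add_card_inter C X
  have h1 : (downEdges G A C ∪ downEdges G (verticesIn X) X) ∪ downEdges G {v} X ⊆
      downEdges G A' (C ∪ X) := by
    intro e he
    simp only [Finset.mem_union, mem_downEdges, Finset.mem_singleton] at he ⊢
    rcases he with (⟨h1, h2, h3⟩ | ⟨h1, h2, h3⟩) | ⟨h1, h2, h3⟩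
    · exact ⟨hA' h1, Or.inl h2, h3⟩
    · exact ⟨hXA' h1, Or.inr h2, h3⟩
    · exact ⟨h1 ▸ hvA', Or.inr h2, h3⟩
  have h2 : Disjoint (downEdges G A C ∪ downEdges G (verticesIn X) X) (downEdges G {v} X) := by
    rw [Finset.disjoint_left]
    intro e he he'
    simp only [Finset.mem_union, mem_downEdges, Finset.mem_singleton, mem_verticesIn] at he he'
    rcases he with ⟨h, -⟩ | ⟨h, -⟩
    · exact hA (he'.1 ▸ h)
    · exact absurd (hX _ h) (by rw [he'.1]; exact lt_irrefl _)
  have h3 : downEdges G A C ∩ downEdges G (verticesIn X) X ⊆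
      downEdges G (verticesIn (X ∩ C)) (X ∩ C) := by
    intro e he
    simp only [Finset.mem_inter, mem_downEdges, mem_verticesIn] at he ⊢
    exact ⟨⟨he.2.1, hAC _ he.1.1⟩, ⟨he.2.2.1, he.1.2.1⟩, he.1.2.2⟩
  have h4 := Finset.card_le_card h1
  rw [Finset.card_union_of_disjoint h2] at h4
  have h5 := Finset.card_union_add_card_inter (downEdges G A C) (downEdges G (verticesIn X) X)
  have h6 := Finset.card_le_card h3
  have h7 : ((downEdges G A C).card : ℝ) + edgesIn G X + (downEdges G {v} X).card ≤
      (downEdges G A' (C ∪ X)).card + edgesIn G (X ∩ C) := by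
    unfold edgesIn
    exact_mod_cast (by omega :
      (downEdges G A C).card + (downEdges G (verticesIn X) X).card + (downEdges G {v} X).card ≤
      (downEdges G A' (C ∪ X)).card + (downEdges G (verticesIn (X ∩ C)) (X ∩ C)).card)
  have h8 := mul_le_mul_of_nonneg_left h7 hθ
  unfold rootedExcess
  linarith

/-- If every vertex `v ∈ Z` sees a set `X v` of earlier rounds, then all these sets can be added to
the rounds in `C`, at a total cost of at most the sum of their excesses, no matter how they
overlap. The vertices of `Z` are treated in the order in which they appear in the game. The
downward edges of the vertices in `Q` are never counted. -/
lemma exists_exploration {θ : ℝ} (hθ : 0 ≤ θ) (X : Fin N × Fin r → Finset (Fin N))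
    (hX : ∀ v, ∀ t ∈ X v, t < v.1)
    (hsparse : ∀ v, ∀ Y ⊆ X v, θ * edgesIn G Y ≤ Y.card)
    (Q : Finset (Fin N × Fin r)) (Z : Finset (Fin N × Fin r)) :
    (∀ q ∈ Q, ∀ z ∈ Z, z.1 < q.1) → ∀ C : Finset (Fin N), (∀ z ∈ Z, z.1 ∈ C) →
    ∃ C' : Finset (Fin N), C ⊆ C' ∧ (∀ t ∈ C', t ∈ C ∨ ∃ z ∈ Z, t < z.1) ∧
      C'.card ≤ C.card + ∑ v ∈ Z, (X v).card ∧
      (C'.card : ℝ) - θ * (downEdges G (verticesIn C' \ Q) C').card ≤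
        C.card - θ * (downEdges G (verticesIn C \ (Z ∪ Q)) C).card +
          ∑ v ∈ Z, rootedExcess G θ v (X v) := by
  induction Z using Finset.induction_on_min_value (fun v : Fin N × Fin r => v.1) with
  | empty =>
    intro _ C _
    exact ⟨C, subset_rfl, fun t ht => Or.inl ht, by simp, by simp⟩
  | insert a Z ha hmin ih =>
    intro hQ C hC
    have haQ : a ∉ Q := fun h => lt_irrefl _ (hQ a h a (by simp))
    obtain ⟨C', h1, h2, h3, h4⟩ := ih (fun q hq z hz => hQ q hq z (by simp [hz])) (C ∪ X a)
      (fun z hz => Finset.mem_union_left _ (hC z (by simp [hz])))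
    refine ⟨C', (Finset.subset_union_left).trans h1, ?_, ?_, ?_⟩
    · intro t ht
      rcases h2 t ht with h | ⟨z, hz, hlt⟩
      · rcases Finset.mem_union.1 h with h | h
        · exact Or.inl h
        · exact Or.inr ⟨a, by simp, hX a t h⟩
      · exact Or.inr ⟨z, by simp [hz], hlt⟩
    · rw [Finset.sum_insert ha]
      have := Finset.card_union_le C (X a)
      omega
    · rw [Finset.sum_insert ha]
      have hstep := card_sub_edges_union_le G hθ (C := C) (X := X a) (v := a)
        (A := verticesIn C \ (insert a Z ∪ Q)) (A' := verticesIn (C ∪ X a) \ (Z ∪ Q)) (hX a)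
        (by simp) ?_ ?_ ?_ (by simp +contextual) (hsparse a _ Finset.inter_subset_left)
      · linarith
      · intro x hx
        simp only [Finset.mem_sdiff, Finset.mem_union, mem_verticesIn, Finset.mem_insert] at hx ⊢
        tauto
      · simp only [Finset.mem_sdiff, Finset.mem_union, mem_verticesIn]
        exact ⟨Or.inl (hC a (by simp)), by tauto⟩
      · intro x hx
        simp only [Finset.mem_sdiff, Finset.mem_union, mem_verticesIn] at hx ⊢
        refine ⟨Or.inr hx, ?_⟩
        rintro (h | h)
        · exact absurd (hX a _ hx) (not_lt.2 (hmin x h))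
        · exact lt_asymm (hX a _ hx) (hQ x h a (by simp))

end Exploration

/-! ### Ordered subgraphs and the coefficients -/

section Coefficients

open Classical

variable {V : Type*} [Fintype V] {F : SimpleGraph V}

/-- The number of edges of `F` inside a vertex set `S`; each edge is counted once, from its end of
smaller position. -/
def edgesWithin (F : SimpleGraph V) (π : VertexOrdering V) (S : Finset V) : ℕ :=
  (Finset.univ.filter fun e : V × V => e.1 ∈ S ∧ e.2 ∈ S ∧ π e.1 < π e.2 ∧ F.Adj e.1 e.2).card

lemma ncard_edgeSet_le_edgesWithin (π : VertexOrdering V) (H : F.Subgraph) :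
    H.edgeSet.ncard ≤ edgesWithin F π H.verts.toFinset := by
  have : H.edgeSet ⊆ ((Finset.univ.filter fun e : V × V => e.1 ∈ H.verts.toFinset ∧
      e.2 ∈ H.verts.toFinset ∧ π e.1 < π e.2 ∧ F.Adj e.1 e.2).image
        (fun e => s(e.1, e.2)) : Finset (Sym2 V)) := by
    intro e
    induction e with
    | _ x y =>
      intro h
      have hxy : H.Adj x y := h
      have hne : π x ≠ π y := fun h => hxy.ne (π.injective h)
      simp only [Finset.coe_image, Set.mem_image, Finset.mem_coe, Finset.mem_filter,
        Finset.mem_univ, true_and, Set.mem_toFinset]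
      rcases lt_or_gt_of_ne hne with hlt | hlt
      · exact ⟨(x, y), ⟨hxy.fst_mem, hxy.snd_mem, hlt, hxy.adj_sub⟩, rfl⟩
      · exact ⟨(y, x), ⟨hxy.snd_mem, hxy.fst_mem, hlt, hxy.adj_sub.symm⟩, Sym2.eq_swap⟩
  calc H.edgeSet.ncard ≤ _ := Set.ncard_le_ncard this (Finset.finite_toSet _)
    _ = _ := Set.ncard_coe_finset _
    _ ≤ _ := Finset.card_image_le

lemma edgesWithin_le_ncard_edgeSet_induce (π : VertexOrdering V) (S : Finset V) :
    edgesWithin F π S ≤ ((⊤ : F.Subgraph).induce S).edgeSet.ncard := by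
  unfold edgesWithin
  rw [← Set.ncard_coe_finset]
  refine Set.ncard_le_ncard_of_injOn (fun e => s(e.1, e.2)) ?_ ?_ (Set.toFinite _)
  · rintro ⟨x, y⟩ h
    simp only [Finset.coe_filter, Finset.mem_univ, true_and, Set.mem_ofPred_eq] at h
    simpa using ⟨h.1, h.2.1, h.2.2.2⟩
  · rintro ⟨x, y⟩ h ⟨x', y'⟩ h' heq
    simp only [Finset.coe_filter, Finset.mem_univ, true_and, Set.mem_ofPred_eq] at h h'
    simp only [Sym2.eq_iff] at heq
    rcases heq with ⟨rfl, rfl⟩ | ⟨rfl, rfl⟩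
    · rfl
    · exact absurd h.2.2.1 (lt_asymm h'.2.2.1)

lemma exists_natCast_eq_coeff {r : ℕ} (hr : 1 ≤ r) (π : VertexOrdering V) (H₁ : F.Subgraph)
    (Hs : V → F.Subgraph) (u : V) : ∃ k : ℕ, coeff r π H₁ Hs u = k := by
  induction hn : (π u).val using Nat.strong_induction_on generalizing u with
  | _ n ih =>
    subst hn
    rw [coeff]
    split_ifs with h
    · exact ⟨r, rfl⟩
    · choose f hf using fun w : {w : V // w ∈ H₁.verts ∧ π w < π u ∧ u ∈ (Hs w).verts} =>
        ih (π w.1).val w.2.2.1 w.1 rfl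
      refine ⟨(r - 1) * ∑ w, f w, ?_⟩
      simp_rw [hf]
      push_cast [Nat.cast_sub hr]
      ring

lemma coeff_nonneg {r : ℕ} (hr : 1 ≤ r) (π : VertexOrdering V) (H₁ : F.Subgraph)
    (Hs : V → F.Subgraph) (u : V) : 0 ≤ coeff r π H₁ Hs u := by
  obtain ⟨k, hk⟩ := exists_natCast_eq_coeff hr π H₁ Hs u
  rw [hk]; positivity

lemma IsYoungest.eq {π : VertexOrdering V} {H : F.Subgraph} {u w : V} (hu : IsYoungest π H u)
    (hw : IsYoungest π H w) : u = w :=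
  π.injective (le_antisymm (hu.2 w hw.1) (hw.2 u hu.1))

lemma exists_isYoungest (π : VertexOrdering V) {H : F.Subgraph} (hH : H.verts.Nonempty) :
    ∃ u, IsYoungest π H u := by
  obtain ⟨u, hu, hmin⟩ := Finset.exists_min_image H.verts.toFinset π (by simpa using hH)
  exact ⟨u, by simpa using hu, fun w hw => hmin w (by simpa using hw)⟩

/-- The recursion of the coefficients, read as a duality: it turns a family of local quantities
attached to the members of the sequence into the one at the youngest vertex. -/
lemma sum_coeff_mul_eq {r : ℕ} {π : VertexOrdering V} {H₁ : F.Subgraph} {Hs : V → F.Subgraph}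
    {u₁ : V} (hu₁ : IsYoungest π H₁ u₁) (hs : IsSubgraphSequence π H₁ Hs) (D : V → ℝ) :
    ∑ u ∈ H₁.verts.toFinset, coeff r π H₁ Hs u *
      (D u - (r - 1) * ∑ w ∈ (Hs u).verts.toFinset.erase u, D w) = r * D u₁ := by
  have hrec : ∀ w ∈ H₁.verts.toFinset, coeff r π H₁ Hs w -
      (r - 1) * ∑ u ∈ H₁.verts.toFinset with w ∈ (Hs u).verts.toFinset.erase u,
        coeff r π H₁ Hs u = if w = u₁ then (r : ℝ) else 0 := by
    intro w hw
    have hw' : w ∈ H₁.verts := by simpa using hw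
    by_cases hwy : w = u₁
    · subst hwy
      have : (H₁.verts.toFinset.filter fun u => w ∈ (Hs u).verts.toFinset.erase u) = ∅ := by
        ext u
        simp only [Finset.mem_filter, Set.mem_toFinset, Finset.mem_erase, Finset.notMem_empty,
          iff_false, not_and]
        intro hu hne hwu
        have h1 := hs.avoids u hu w hwu
        have h2 := hu₁.2 u hu
        exact hne (π.injective (le_antisymm h2 h1))
      rw [this, coeff, if_pos hu₁]
      simp
    · rw [if_neg hwy, coeff, if_neg fun h => hwy (h.eq hu₁)]
      rw [sub_eq_zero]
      congr 1
      have hset : (H₁.verts.toFinset.filter fun u => w ∈ (Hs u).verts.toFinset.erase u) =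
          Finset.univ.filter fun u => u ∈ H₁.verts ∧ π u < π w ∧ w ∈ (Hs u).verts := by
        ext u
        simp only [Finset.mem_filter, Set.mem_toFinset, Finset.mem_erase, Finset.mem_univ, true_and]
        constructor
        · rintro ⟨h1, h2, h3⟩
          exact ⟨h1, lt_of_le_of_ne (hs.avoids u h1 w h3) fun h => h2 (π.injective h.symm), h3⟩
        · rintro ⟨h1, h2, h3⟩
          exact ⟨h1, by rintro rfl; exact lt_irrefl _ h2, h3⟩
      rw [hset]
      symm
      exact Finset.sum_subtype _ (by simp) _
  calc ∑ u ∈ H₁.verts.toFinset, coeff r π H₁ Hs u *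
        (D u - (r - 1) * ∑ w ∈ (Hs u).verts.toFinset.erase u, D w)
      = ∑ u ∈ H₁.verts.toFinset, coeff r π H₁ Hs u * D u -
        (r - 1) * ∑ u ∈ H₁.verts.toFinset, ∑ w ∈ H₁.verts.toFinset,
          if w ∈ (Hs u).verts.toFinset.erase u then coeff r π H₁ Hs u * D w else 0 := by
        rw [Finset.mul_sum, ← Finset.sum_sub_distrib]
        refine Finset.sum_congr rfl fun u hu => ?_
        rw [← Finset.sum_filter]
        have : (H₁.verts.toFinset.filter fun w => w ∈ (Hs u).verts.toFinset.erase u) =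
            (Hs u).verts.toFinset.erase u := by
          ext w
          simp only [Finset.mem_filter, Set.mem_toFinset, Finset.mem_erase, and_iff_right_iff_imp]
          exact fun h => (hs.subgraph u (by simpa using hu)).1 h.2
        rw [this, ← Finset.mul_sum]
        ring
    _ = ∑ w ∈ H₁.verts.toFinset, (coeff r π H₁ Hs w -
          (r - 1) * ∑ u ∈ H₁.verts.toFinset with w ∈ (Hs u).verts.toFinset.erase u,
            coeff r π H₁ Hs u) * D w := by
        rw [Finset.sum_comm, Finset.mul_sum, ← Finset.sum_sub_distrib]
        refine Finset.sum_congr rfl fun w _ => ?_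
        rw [← Finset.sum_filter, ← Finset.sum_mul]
        ring
    _ = ∑ w ∈ H₁.verts.toFinset, if w = u₁ then (r : ℝ) * D w else 0 := by
        refine Finset.sum_congr rfl fun w hw => ?_
        rw [hrec w hw]
        split_ifs <;> simp
    _ = r * D u₁ := by
        rw [Finset.sum_ite_eq' _ _ fun w => (r : ℝ) * D w, if_pos (by simpa using hu₁.1)]

/-- The numerator of `densityRatio`. -/
def weightedEdges (r : ℕ) (π : VertexOrdering V) (H₁ : F.Subgraph) (Hs : V → F.Subgraph) : ℝ :=
  ∑ u ∈ H₁.verts.toFinset, coeff r π H₁ Hs u * ((Hs u).edgeSet.ncard : ℝ)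

/-- The denominator of `densityRatio`. -/
def weightedBlocks (r : ℕ) (π : VertexOrdering V) (H₁ : F.Subgraph) (Hs : V → F.Subgraph) : ℝ :=
  1 + ∑ u ∈ H₁.verts.toFinset, coeff r π H₁ Hs u * (((Hs u).verts.ncard : ℝ) - 1)

lemma densityRatio_eq (r : ℕ) (π : VertexOrdering V) (H₁ : F.Subgraph) (Hs : V → F.Subgraph) :
    densityRatio r π H₁ Hs = weightedEdges r π H₁ Hs / weightedBlocks r π H₁ Hs := by
  unfold densityRatio weightedEdges weightedBlocks
  congr 1
  · exact (Finset.sum_subtype H₁.verts.toFinset (by simp)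
      fun u => coeff r π H₁ Hs u * ((Hs u).edgeSet.ncard : ℝ)).symm
  · congr 1
    exact (Finset.sum_subtype H₁.verts.toFinset (by simp)
      fun u => coeff r π H₁ Hs u * (((Hs u).verts.ncard : ℝ) - 1)).symm

lemma IsSubgraphSequence.one_le_ncard_verts {π : VertexOrdering V} {H₁ : F.Subgraph}
    {Hs : V → F.Subgraph} (hs : IsSubgraphSequence π H₁ Hs) {u : V} (hu : u ∈ H₁.verts) :
    1 ≤ (Hs u).verts.ncard :=
  Set.ncard_pos (Set.toFinite _) |>.2 ⟨u, hs.mem u hu⟩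

lemma one_le_weightedBlocks {r : ℕ} (hr : 1 ≤ r) {π : VertexOrdering V} {H₁ : F.Subgraph}
    {Hs : V → F.Subgraph} (hs : IsSubgraphSequence π H₁ Hs) : 1 ≤ weightedBlocks r π H₁ Hs := by
  unfold weightedBlocks
  refine le_add_of_nonneg_right (Finset.sum_nonneg fun u hu => ?_)
  refine mul_nonneg (coeff_nonneg hr _ _ _ _) (sub_nonneg.2 ?_)
  exact_mod_cast hs.one_le_ncard_verts (by simpa using hu)

lemma exists_ratCast_eq_densityRatio {r : ℕ} (hr : 1 ≤ r) (π : VertexOrdering V)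
    (H₁ : F.Subgraph) (Hs : V → F.Subgraph) : ∃ q : ℚ, densityRatio r π H₁ Hs = q := by
  choose c hc using exists_natCast_eq_coeff hr π H₁ Hs
  refine ⟨(∑ u ∈ H₁.verts.toFinset, (c u : ℚ) * ((Hs u).edgeSet.ncard : ℚ)) /
    (1 + ∑ u ∈ H₁.verts.toFinset, (c u : ℚ) * (((Hs u).verts.ncard : ℚ) - 1)), ?_⟩
  rw [densityRatio_eq]
  simp only [weightedEdges, weightedBlocks, hc]
  push_cast
  rfl

/-! ### Attained extrema in the definition of the parameter -/

lemma isSubgraphSequence_singletons (π : VertexOrdering V) (H₁ : F.Subgraph) :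
    ∃ Hs, IsSubgraphSequence π H₁ Hs := by
  refine ⟨fun u => if IsYoungest π H₁ u then H₁ else F.singletonSubgraph u, ?_, ?_, ?_, ?_⟩
  · intro u hu
    simp [hu]
  · intro u hu
    by_cases h : IsYoungest π H₁ u
    · simp [h]
    · simpa [h] using hu
  · intro u hu w hw
    by_cases h : IsYoungest π H₁ u
    · exact h.2 w (by simpa [h] using hw)
    · simp [h] at hw
      simp [hw]
  · intro u hu
    by_cases h : IsYoungest π H₁ u
    · simpa [h] using hu
    · simp [h]

instance (π : VertexOrdering V) (H₁ : F.Subgraph) :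
    Nonempty {Hs : V → F.Subgraph // IsSubgraphSequence π H₁ Hs} :=
  let ⟨Hs, h⟩ := isSubgraphSequence_singletons π H₁
  ⟨⟨Hs, h⟩⟩

instance : Nonempty (VertexOrdering V) := ⟨Fintype.equivFin V⟩

lemma exists_dStar_eq (r : ℕ) (π : VertexOrdering V) (H₁ : F.Subgraph) :
    ∃ Hs, IsSubgraphSequence π H₁ Hs ∧ dStar r π H₁ = densityRatio r π H₁ Hs := by
  obtain ⟨Hs, h⟩ := exists_eq_ciSup_of_finite
    (f := fun Hs : {Hs : V → F.Subgraph // IsSubgraphSequence π H₁ Hs} => densityRatio r π H₁ Hs.1)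
  exact ⟨Hs.1, Hs.2, h.symm⟩

lemma densityRatio_le_dStar (r : ℕ) {π : VertexOrdering V} {H₁ : F.Subgraph}
    {Hs : V → F.Subgraph} (hs : IsSubgraphSequence π H₁ Hs) :
    densityRatio r π H₁ Hs ≤ dStar r π H₁ :=
  le_ciSup (f := fun Hs : {Hs : V → F.Subgraph // IsSubgraphSequence π H₁ Hs} =>
    densityRatio r π H₁ Hs.1) (Set.finite_range _).bddAbove ⟨Hs, hs⟩

lemma exists_mStar_eq (r : ℕ) (F : SimpleGraph V) :
    ∃ π : VertexOrdering V, mStar r F = ⨆ H₁ : F.Subgraph, dStar r π H₁ := by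
  obtain ⟨π, h⟩ := exists_eq_ciInf_of_finite
    (f := fun π : VertexOrdering V => ⨆ H₁ : F.Subgraph, dStar r π H₁)
  exact ⟨π, h.symm⟩

lemma exists_iSup_dStar_eq (r : ℕ) (π : VertexOrdering V) :
    ∃ (H₁ : F.Subgraph) (Hs : V → F.Subgraph), IsSubgraphSequence π H₁ Hs ∧
      ⨆ H₁ : F.Subgraph, dStar r π H₁ = densityRatio r π H₁ Hs := by
  obtain ⟨H₁, h⟩ := exists_eq_ciSup_of_finite (f := fun H₁ : F.Subgraph => dStar r π H₁)
  obtain ⟨Hs, h1, h2⟩ := exists_dStar_eq r π H₁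
  exact ⟨H₁, Hs, h1, by rw [← h, h2]⟩

lemma exists_mStar_le_densityRatio (r : ℕ) (π : VertexOrdering V) :
    ∃ (H₁ : F.Subgraph) (Hs : V → F.Subgraph), IsSubgraphSequence π H₁ Hs ∧
      mStar r F ≤ densityRatio r π H₁ Hs := by
  obtain ⟨H₁, Hs, h1, h2⟩ := exists_iSup_dStar_eq (F := F) r π
  exact ⟨H₁, Hs, h1, h2 ▸ ciInf_le (Set.finite_range _).bddBelow π⟩

/-- An ordering for which no sequence of subgraphs has a ratio exceeding `mStar r F`. -/
lemma exists_forall_densityRatio_le_mStar (r : ℕ) (F : SimpleGraph V) :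
    ∃ π : VertexOrdering V, ∀ (H₁ : F.Subgraph) (Hs : V → F.Subgraph),
      IsSubgraphSequence π H₁ Hs → densityRatio r π H₁ Hs ≤ mStar r F := by
  obtain ⟨π, h⟩ := exists_mStar_eq r F
  refine ⟨π, fun H₁ Hs hs => (densityRatio_le_dStar r hs).trans ?_⟩
  rw [h]
  exact le_ciSup (f := fun H₁ : F.Subgraph => dStar r π H₁) (Set.finite_range _).bddAbove H₁

lemma exists_ratCast_eq_mStar {r : ℕ} (hr : 1 ≤ r) (F : SimpleGraph V) :
    ∃ q : ℚ, mStar r F = q := by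
  obtain ⟨π, h⟩ := exists_mStar_eq r F
  obtain ⟨H₁, Hs, -, h2⟩ := exists_iSup_dStar_eq (F := F) r π
  rw [h, h2]
  exact exists_ratCast_eq_densityRatio hr π H₁ Hs

/-- Every ordering has a sequence of positive ratio, which starts with the whole graph. -/
lemma mStar_pos {r : ℕ} (hr : 1 ≤ r) (hF : F ≠ ⊥) : 0 < mStar r F := by
  obtain ⟨π, h⟩ := exists_forall_densityRatio_le_mStar r F
  obtain ⟨Hs, hs⟩ := isSubgraphSequence_singletons π (⊤ : F.Subgraph)
  refine lt_of_lt_of_le ?_ (h ⊤ Hs hs)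
  rw [densityRatio_eq]
  refine div_pos ?_ (zero_lt_one.trans_le (one_le_weightedBlocks hr hs))
  obtain ⟨a, b, hab⟩ : ∃ a b, F.Adj a b := by
    by_contra hcon
    push Not at hcon
    exact hF (by ext a b; simp [hcon a b])
  obtain ⟨u, hu⟩ := exists_isYoungest π (H := (⊤ : F.Subgraph)) ⟨a, by simp⟩
  unfold weightedEdges
  refine Finset.sum_pos' (fun w _ => mul_nonneg (coeff_nonneg hr _ _ _ _) (Nat.cast_nonneg _))
    ⟨u, by simp, ?_⟩
  rw [hs.first u hu, coeff, if_pos hu]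
  refine mul_pos (by exact_mod_cast hr) ?_
  have : 0 < ((⊤ : F.Subgraph).edgeSet).ncard :=
    (Set.ncard_pos (Set.toFinite _)).2 ⟨s(a, b), by simpa using hab⟩
  exact_mod_cast this

end Coefficients

/-! ### The strategy of least danger -/

section Strategy

open Classical

variable {N r : ℕ}

/-- The sets of at most `K` rounds, all of them before the round of `v`. -/
def earlierSets (K : ℕ) (v : Fin N × Fin r) : Finset (Finset (Fin N)) :=
  Finset.univ.filter fun X => X.card ≤ K ∧ ∀ t ∈ X, t < v.1

lemma mem_earlierSets {K : ℕ} {v : Fin N × Fin r} {X : Finset (Fin N)} :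
    X ∈ earlierSets K v ↔ X.card ≤ K ∧ ∀ t ∈ X, t < v.1 := by simp [earlierSets]

lemma empty_mem_earlierSets (K : ℕ) (v : Fin N × Fin r) : ∅ ∈ earlierSets K v := by
  simp [mem_earlierSets]

/-- The least excess of a set of at most `K` earlier rounds, seen from `v`. The smaller it is, the
more dangerous it is to select `v`. -/
def minExcess (G : SimpleGraph (Fin N × Fin r)) (θ : ℝ) (K : ℕ) (v : Fin N × Fin r) : ℝ :=
  (earlierSets K v).inf' ⟨∅, empty_mem_earlierSets K v⟩ (rootedExcess G θ v)

lemma minExcess_le {G : SimpleGraph (Fin N × Fin r)} {θ : ℝ} {K : ℕ} {v : Fin N × Fin r}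
    {X : Finset (Fin N)} (hX : X ∈ earlierSets K v) : minExcess G θ K v ≤ rootedExcess G θ v X :=
  Finset.inf'_le _ hX

lemma minExcess_nonpos (G : SimpleGraph (Fin N × Fin r)) (θ : ℝ) (K : ℕ) (v : Fin N × Fin r) :
    minExcess G θ K v ≤ 0 :=
  (minExcess_le (empty_mem_earlierSets K v)).trans_eq (rootedExcess_empty G θ v)

lemma exists_rootedExcess_eq_minExcess (G : SimpleGraph (Fin N × Fin r)) (θ : ℝ) (K : ℕ)
    (v : Fin N × Fin r) : ∃ X ∈ earlierSets K v, rootedExcess G θ v X = minExcess G θ K v := by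
  obtain ⟨X, hX, h⟩ := Finset.exists_mem_eq_inf' ⟨∅, empty_mem_earlierSets K v⟩
    (rootedExcess G θ v)
  exact ⟨X, hX, h.symm⟩

/-- The danger of `v` is determined by what is revealed in the round of `v`. -/
lemma minExcess_congr {G G' : SimpleGraph (Fin N × Fin r)} {v : Fin N × Fin r}
    (h : ∀ a b : Fin N × Fin r, a.1 ≤ v.1 → b.1 ≤ v.1 → (G.Adj a b ↔ G'.Adj a b))
    (θ : ℝ) (K : ℕ) : minExcess G θ K v = minExcess G' θ K v := by
  have key : ∀ (A : Finset (Fin N × Fin r)) (X : Finset (Fin N)), (∀ a ∈ A, a.1 ≤ v.1) →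
      (∀ t ∈ X, t < v.1) → downEdges G A X = downEdges G' A X := by
    intro A X hA hX
    ext e
    rw [mem_downEdges, mem_downEdges]
    refine and_congr_right fun h1 => and_congr_right fun h2 => and_congr_right fun _ => ?_
    exact h _ _ (hA _ h1) (hX _ h2).le
  refine Finset.inf'_congr _ rfl fun X hX => ?_
  have hX' := (mem_earlierSets.1 hX).2
  unfold rootedExcess edgesIn
  rw [key _ X (fun a ha => (hX' _ (mem_verticesIn.1 ha)).le) hX', key {v} X (by simp) hX']

/-- The index of a largest value. -/
def argmax (hr : 0 < r) (f : Fin r → ℝ) : Fin r :=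
  (Finset.exists_max_image Finset.univ f ⟨⟨0, hr⟩, Finset.mem_univ _⟩).choose

lemma le_argmax (hr : 0 < r) (f : Fin r → ℝ) (j : Fin r) : f j ≤ f (argmax hr f) :=
  (Finset.exists_max_image Finset.univ f ⟨⟨0, hr⟩, Finset.mem_univ _⟩).choose_spec.2 j
    (Finset.mem_univ _)

/-- In every round the player selects a vertex of least danger. -/
def leastDanger (N : ℕ) (hr : 0 < r) (θ : ℝ) (K : ℕ) : Strategy N r := fun i G' =>
  argmax hr fun j => minExcess (G'.map (Function.Embedding.subtype _)) θ K (i, j)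

/-- The index of the vertex selected in round `t`. -/
def choice (σ : Strategy N r) (G : SimpleGraph (Fin N × Fin r)) (t : Fin N) : Fin r :=
  σ t (G.induce (revealed r t))

lemma minExcess_le_choice (hr : 0 < r) (θ : ℝ) (K : ℕ) (G : SimpleGraph (Fin N × Fin r))
    (t : Fin N) (j : Fin r) :
    minExcess G θ K (t, j) ≤ minExcess G θ K (t, choice (leastDanger N hr θ K) G t) := by
  have key : ∀ j : Fin r, minExcess ((G.induce (revealed r t)).map (Function.Embedding.subtype _))
      θ K (t, j) = minExcess G θ K (t, j) := by
    intro j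
    refine minExcess_congr (fun a b ha hb => ?_) θ K
    simp only [SimpleGraph.map_adj, SimpleGraph.comap_adj, Function.Embedding.subtype_apply,
      Subtype.exists]
    constructor
    · rintro ⟨a', -, b', -, h, rfl, rfl⟩
      exact h
    · intro h
      exact ⟨a, ha, b, hb, h, rfl, rfl⟩
  have := le_argmax hr (fun j => minExcess ((G.induce (revealed r t)).map
    (Function.Embedding.subtype _)) θ K (t, j)) j
  simp only [key] at this
  convert this using 2
  unfold choice leastDanger
  simp only [key]

/-- Every nonempty set of at most `K` rounds has more rounds than `θ` times its edges. -/
def IsSparse (G : SimpleGraph (Fin N × Fin r)) (θ : ℝ) (K : ℕ) : Prop :=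
  ∀ B : Finset (Fin N), B.Nonempty → B.card ≤ K → θ * edgesIn G B < B.card

lemma IsSparse.le {G : SimpleGraph (Fin N × Fin r)} {θ : ℝ} {K : ℕ} (h : IsSparse G θ K)
    {B : Finset (Fin N)} (hB : B.card ≤ K) : θ * edgesIn G B ≤ B.card := by
  rcases B.eq_empty_or_nonempty with rfl | hne
  · simp [edgesIn, downEdges]
  · exact (h B hne hB).le

/-- Lowering the exponent from `θ` to `θ'` bounds the size of the dangerous configurations, since
every edge adds `θ - θ'` to the excess. -/
lemma IsSparse.card_le_of_rootedExcess_nonpos {G : SimpleGraph (Fin N × Fin r)} {θ θ' : ℝ}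
    {K K₁ : ℕ} (h : IsSparse G θ (K + 1)) (hθ' : 0 ≤ θ') (hlt : θ' < θ)
    (hK₁ : θ' ≤ K₁ * (θ - θ')) {v : Fin N × Fin r} {X : Finset (Fin N)}
    (hX : X ∈ earlierSets K v) (hex : rootedExcess G θ' v X ≤ 0) : X.card ≤ K₁ := by
  obtain ⟨hcard, hlt'⟩ := mem_earlierSets.1 hX
  have hv : v.1 ∉ X := fun hv => lt_irrefl _ (hlt' _ hv)
  have h1 := h (insert v.1 X) ⟨_, Finset.mem_insert_self _ _⟩
    (by rw [Finset.card_insert_of_notMem hv]; omega)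
  rw [Finset.card_insert_of_notMem hv] at h1
  have h2 : edgesIn G X + (downEdges G {v} X).card ≤ edgesIn G (insert v.1 X) := by
    unfold edgesIn
    rw [← Finset.card_union_of_disjoint]
    · refine Finset.card_le_card fun e he => ?_
      simp only [Finset.mem_union, mem_downEdges, mem_verticesIn, Finset.mem_singleton,
        Finset.mem_insert] at he ⊢
      rcases he with ⟨h1, h2, h3⟩ | ⟨h1, h2, h3⟩
      · exact ⟨Or.inr h1, Or.inr h2, h3⟩
      · exact ⟨Or.inl (by rw [h1]), Or.inr h2, h3⟩
    · rw [Finset.disjoint_left]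
      intro e he he'
      simp only [mem_downEdges, mem_verticesIn, Finset.mem_singleton] at he he'
      exact hv (he'.1 ▸ he.1)
  unfold rootedExcess at hex
  have h3 : ((edgesIn G X : ℝ) + (downEdges G {v} X).card) ≤ edgesIn G (insert v.1 X) := by
    exact_mod_cast h2
  set E : ℝ := (edgesIn G X : ℝ) + (downEdges G {v} X).card with hE
  have hE0 : 0 ≤ E := by positivity
  push_cast at h1
  have h4 : (θ - θ') * E < 1 := by
    have := mul_le_mul_of_nonneg_left h3 (hθ'.trans hlt.le)
    nlinarith
  have h5 : (X.card : ℝ) * (θ - θ') ≤ K₁ * (θ - θ') := by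
    have := mul_le_mul_of_nonneg_right (sub_nonpos.1 hex) (sub_pos.2 hlt).le
    have h6 := mul_le_mul_of_nonneg_left h4.le hθ'
    nlinarith
  exact_mod_cast le_of_mul_le_mul_right h5 (sub_pos.2 hlt)

variable {V : Type*} [Fintype V] {F : SimpleGraph V}

/-- Consider a selected copy of `F`, created in the reverse order of `π`, and let `S` be a set of
its vertices with last vertex `u`. When a vertex `w ∈ S` was selected, its `r - 1` competitors were
at least as dangerous. The copy of `S` and the configurations seen by all these competitors
together form a configuration seen by `u`. -/
lemma minExcess_selected_le {G : SimpleGraph (Fin N × Fin r)} {θ θ' : ℝ} {K K₁ : ℕ}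
    (hsp : IsSparse G θ (K + 1)) (hθ' : 0 ≤ θ') (hlt : θ' < θ) (hK₁ : θ' ≤ K₁ * (θ - θ'))
    (hK : Fintype.card V + Fintype.card V * r * K₁ ≤ K)
    (s : Fin N → Fin r) (hs : ∀ t j, minExcess G θ' K (t, j) ≤ minExcess G θ' K (t, s t))
    (π : VertexOrdering V) (τ : V → Fin N) (hτ : ∀ u w, π u < π w → τ w < τ u)
    (hG : ∀ u w, F.Adj u w → G.Adj (τ u, s (τ u)) (τ w, s (τ w)))
    (S : Finset V) (u : V) (hu : u ∈ S) (hmin : ∀ w ∈ S, π u ≤ π w) (hr : 1 ≤ r) :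
    minExcess G θ' K (τ u, s (τ u)) ≤ (S.card : ℝ) - 1 - θ' * edgesWithin F π S +
      (r - 1) * ∑ w ∈ S.erase u, minExcess G θ' K (τ w, s (τ w)) := by
  have hinj : Function.Injective τ := by
    intro a b hab
    by_contra hne
    rcases lt_or_gt_of_ne (fun h => hne (π.injective h)) with h | h
    · exact absurd (hτ _ _ h) (by rw [hab]; exact lt_irrefl _)
    · exact absurd (hτ _ _ h) (by rw [hab]; exact lt_irrefl _)
  have hlast : ∀ w ∈ S.erase u, τ w < τ u := by
    intro w hw
    rw [Finset.mem_erase] at hw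
    exact hτ _ _ (lt_of_le_of_ne (hmin w hw.2) fun h => hw.1 (π.injective h.symm))
  choose X hXmem hXeq using exists_rootedExcess_eq_minExcess G θ' K
  have hXcard : ∀ v, (X v).card ≤ K₁ := fun v =>
    hsp.card_le_of_rootedExcess_nonpos hθ' hlt hK₁ (hXmem v)
      ((hXeq v).trans_le (minExcess_nonpos _ _ _ _))
  have hsparse : ∀ Y : Finset (Fin N), Y.card ≤ K → θ' * edgesIn G Y ≤ Y.card := fun Y hY =>
    (mul_le_mul_of_nonneg_right hlt.le (Nat.cast_nonneg _)).trans (hsp.le (hY.trans (Nat.le_succ _)))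
  -- `Z` consists of the competitors of the vertices of `S` other than `u`. Those of `u` itself, the
  -- set `Q`, are not part of a configuration seen by `u`.
  set Z₀ : Finset (V × Fin r) := (S.erase u ×ˢ Finset.univ).filter fun x => x.2 ≠ s (τ x.1) with hZ₀
  have hZinj : Function.Injective fun x : V × Fin r => (τ x.1, x.2) := by
    rintro ⟨a, b⟩ ⟨c, d⟩ h
    simp only [Prod.mk.injEq] at h
    rw [hinj h.1, h.2]
  set Z := Z₀.image fun x : V × Fin r => (τ x.1, x.2) with hZ
  set Q : Finset (Fin N × Fin r) := Finset.univ.filter fun v => v.1 = τ u ∧ v.2 ≠ s (τ u) with hQ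
  have hZmem : ∀ z, z ∈ Z ↔ ∃ w ∈ S.erase u, z.1 = τ w ∧ z.2 ≠ s (τ w) := by
    rintro ⟨t, j⟩
    simp only [hZ, hZ₀, Finset.mem_image, Finset.mem_filter, Finset.mem_product, Finset.mem_univ,
      and_true, Prod.exists, Prod.mk.injEq]
    constructor
    · rintro ⟨w, j, ⟨h1, h2⟩, rfl, rfl⟩
      exact ⟨w, h1, rfl, h2⟩
    · rintro ⟨w, h1, rfl, h2⟩
      exact ⟨w, j, ⟨h1, h2⟩, rfl, rfl⟩
  have hZcard : Z.card ≤ Fintype.card V * r := by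
    calc Z.card ≤ Z₀.card := Finset.card_image_le
      _ ≤ (S.erase u ×ˢ (Finset.univ : Finset (Fin r))).card := Finset.card_filter_le _ _
      _ = (S.erase u).card * r := by rw [Finset.card_product, Finset.card_univ, Fintype.card_fin]
      _ ≤ _ := Nat.mul_le_mul_right _ (Finset.card_le_univ _)
  have hZsum : ∑ v ∈ Z, minExcess G θ' K v ≤
      (r - 1) * ∑ w ∈ S.erase u, minExcess G θ' K (τ w, s (τ w)) := by
    rw [hZ, Finset.sum_image fun x _ y _ h => hZinj h, hZ₀, Finset.sum_filter, Finset.sum_product,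
      Finset.mul_sum]
    refine Finset.sum_le_sum fun w _ => ?_
    rw [← Finset.sum_filter]
    refine (Finset.sum_le_card_nsmul _ _ _ fun j _ => hs (τ w) j).trans_eq ?_
    have : (Finset.univ.filter fun j : Fin r => j ≠ s (τ w)).card = r - 1 := by
      rw [Finset.filter_ne', Finset.card_erase_of_mem (Finset.mem_univ _), Finset.card_univ,
        Fintype.card_fin]
    simp only [this, nsmul_eq_mul]
    rw [Nat.cast_sub hr, Nat.cast_one]
  obtain ⟨C, hC1, hC2, hC3, hC4⟩ := exists_exploration G hθ' X
    (fun v => (mem_earlierSets.1 (hXmem v)).2)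
    (fun v Y hY => hsparse Y ((Finset.card_le_card hY).trans (mem_earlierSets.1 (hXmem v)).1))
    Q Z (by
      intro q hq z hz
      obtain ⟨w, hw, hzw, -⟩ := (hZmem z).1 hz
      rw [hzw, (Finset.mem_filter.1 hq).2.1]
      exact hlast w hw) (S.image τ) (by
      intro z hz
      obtain ⟨w, hw, hzw, -⟩ := (hZmem z).1 hz
      exact Finset.mem_image.2 ⟨w, Finset.mem_of_mem_erase hw, hzw.symm⟩)
  simp_rw [hXeq] at hC4
  rw [Finset.card_image_of_injective _ hinj] at hC3 hC4
  have hCle : ∀ t ∈ C, t ≠ τ u → t < τ u := by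
    intro t ht hne
    rcases hC2 t ht with h | ⟨z, hz, hlt⟩
    · obtain ⟨w, hw, rfl⟩ := Finset.mem_image.1 h
      exact hlast w (Finset.mem_erase.2 ⟨fun h => hne (by rw [h]), hw⟩)
    · obtain ⟨w, hw, hzw, -⟩ := (hZmem z).1 hz
      exact (hzw ▸ hlt).trans (hlast w hw)
  have huC : τ u ∈ C := hC1 (Finset.mem_image_of_mem _ hu)
  have hCcard : C.card ≤ K := by
    have h1 : ∑ v ∈ Z, (X v).card ≤ Z.card * K₁ := by
      simpa using Finset.sum_le_card_nsmul Z _ K₁ fun v _ => hXcard v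
    have h2 := Nat.mul_le_mul_right K₁ hZcard
    have h3 : S.card ≤ Fintype.card V := Finset.card_le_univ _
    omega
  have hcand : C.erase (τ u) ∈ earlierSets K (τ u, s (τ u)) := by
    rw [mem_earlierSets]
    refine ⟨(Finset.card_erase_le).trans hCcard, fun t ht => ?_⟩
    rw [Finset.mem_erase] at ht
    exact hCle t ht.2 ht.1
  refine (minExcess_le hcand).trans ?_
  -- At the start of the exploration only the edges of the copy are counted.
  have hcopy : edgesWithin F π S ≤
      (downEdges G (verticesIn (S.image τ) \ (Z ∪ Q)) (S.image τ)).card := by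
    unfold edgesWithin
    refine Finset.card_le_card_of_injOn
      (fun e => ((τ e.1, s (τ e.1)), (τ e.2, s (τ e.2)))) ?_ ?_
    · rintro ⟨x, y⟩ h
      simp only [Finset.coe_filter, Finset.mem_univ, true_and, Set.mem_ofPred_eq] at h
      obtain ⟨hx, hy, hlt, hadj⟩ := h
      simp only [Finset.mem_coe, mem_downEdges, Finset.mem_sdiff, mem_verticesIn,
        Finset.mem_union, not_or]
      refine ⟨⟨Finset.mem_image_of_mem _ hx, ?_, ?_⟩, Finset.mem_image_of_mem _ hy, hτ _ _ hlt,
        hG _ _ hadj⟩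
      · rw [hZmem]
        rintro ⟨w, -, h1, h2⟩
        exact h2 (by rw [← h1])
      · simp only [hQ, Finset.mem_filter, Finset.mem_univ, true_and, not_and, not_not]
        intro h
        rw [h]
    · rintro ⟨x, y⟩ - ⟨x', y'⟩ - h
      simp only [Prod.mk.injEq] at h
      rw [hinj h.1.1, hinj h.2.1]
  -- The round of `u` is the last one of `C`, and only `u` is counted there.
  have hroot : (downEdges G (verticesIn C \ Q) C).card ≤
      edgesIn G (C.erase (τ u)) + (downEdges G {(τ u, s (τ u))} (C.erase (τ u))).card := by
    unfold edgesIn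
    refine (Finset.card_le_card ?_).trans (Finset.card_union_le _ _)
    rintro ⟨⟨t, j⟩, w⟩ he
    simp only [mem_downEdges, Finset.mem_sdiff, mem_verticesIn, hQ, Finset.mem_filter,
      Finset.mem_univ, true_and, not_and, not_not, Finset.mem_union, Finset.mem_singleton,
      Finset.mem_erase] at he ⊢
    obtain ⟨⟨h1, h2⟩, h3, h4, h5⟩ := he
    have hw : w.1 ≠ τ u := by
      intro hw
      by_cases h : t = τ u
      · rw [h, hw] at h4; exact lt_irrefl _ h4
      · rw [hw] at h4; exact lt_asymm h4 (hCle t h1 h)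
    by_cases h : t = τ u
    · exact Or.inr ⟨by rw [h, h2 h], ⟨hw, h3⟩, h4, h5⟩
    · exact Or.inl ⟨⟨h, h1⟩, ⟨hw, h3⟩, h4, h5⟩
  unfold rootedExcess
  have hc : ((C.erase (τ u)).card : ℝ) = C.card - 1 := by
    rw [Finset.card_erase_of_mem huC, Nat.cast_sub (Finset.card_pos.2 ⟨_, huC⟩), Nat.cast_one]
  have h1 : θ' * ((downEdges G (verticesIn C \ Q) C).card : ℝ) ≤ θ' *
      (edgesIn G (C.erase (τ u)) + (downEdges G {(τ u, s (τ u))} (C.erase (τ u))).card) :=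
    mul_le_mul_of_nonneg_left (by exact_mod_cast hroot) hθ'
  have h2 : θ' * (edgesWithin F π S : ℝ) ≤
      θ' * (downEdges G (verticesIn (S.image τ) \ (Z ∪ Q)) (S.image τ)).card :=
    mul_le_mul_of_nonneg_left (by exact_mod_cast hcopy) hθ'
  rw [hc]
  linarith

/-- If the vertex selected in round `t` is dangerous, then so are all the vertices of this round,
and the configurations that they see form a dense set of rounds. -/
lemma exists_card_sub_edgesIn_le {G : SimpleGraph (Fin N × Fin r)} {θ θ' : ℝ} {K K₁ : ℕ}
    (hsp : IsSparse G θ (K + 1)) (hθ' : 0 ≤ θ') (hlt : θ' < θ) (hK₁ : θ' ≤ K₁ * (θ - θ'))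
    (s : Fin N → Fin r) (hs : ∀ t j, minExcess G θ' K (t, j) ≤ minExcess G θ' K (t, s t))
    (t : Fin N) (hK : r * K₁ ≤ K) :
    ∃ B : Finset (Fin N), B.Nonempty ∧ B.card ≤ K + 1 ∧
      (B.card : ℝ) - θ' * edgesIn G B ≤ 1 + r * minExcess G θ' K (t, s t) := by
  choose X hXmem hXeq using exists_rootedExcess_eq_minExcess G θ' K
  have hXcard : ∀ v, (X v).card ≤ K₁ := fun v =>
    hsp.card_le_of_rootedExcess_nonpos hθ' hlt hK₁ (hXmem v)
      ((hXeq v).trans_le (minExcess_nonpos _ _ _ _))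
  have hsparse : ∀ Y : Finset (Fin N), Y.card ≤ K → θ' * edgesIn G Y ≤ Y.card := fun Y hY =>
    (mul_le_mul_of_nonneg_right hlt.le (Nat.cast_nonneg _)).trans (hsp.le (hY.trans (Nat.le_succ _)))
  have hv : (verticesIn {t} : Finset (Fin N × Fin r)) = Finset.univ.image fun j => (t, j) := by
    ext ⟨a, b⟩
    simp [eq_comm]
  have hinj : Function.Injective fun j : Fin r => (t, j) := fun a b h => by simpa using h
  obtain ⟨B, hB1, -, hB3, hB4⟩ := exists_exploration G hθ' X
    (fun v => (mem_earlierSets.1 (hXmem v)).2)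
    (fun v Y hY => hsparse Y ((Finset.card_le_card hY).trans (mem_earlierSets.1 (hXmem v)).1))
    ∅ (verticesIn {t}) (by simp) {t} (by simp)
  simp_rw [hXeq] at hB4
  refine ⟨B, ⟨t, hB1 (by simp)⟩, ?_, ?_⟩
  · have h1 := Finset.sum_le_card_nsmul (verticesIn {t}) (fun v => (X v).card) K₁
      fun v _ => hXcard v
    rw [hv, Finset.card_image_of_injective _ hinj, Finset.card_univ, Fintype.card_fin,
      smul_eq_mul, ← hv] at h1
    rw [Finset.card_singleton] at hB3
    omega
  · rw [hv, Finset.sum_image fun x _ y _ h => hinj h, ← hv] at hB4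
    have h1 := Finset.sum_le_card_nsmul Finset.univ (fun j => minExcess G θ' K (t, j)) _
      fun j _ => hs t j
    rw [Finset.card_univ, Fintype.card_fin, nsmul_eq_mul] at h1
    simp only [Finset.sdiff_empty, Finset.card_singleton, Nat.cast_one, Finset.union_empty,
      Finset.sdiff_self] at hB4
    have h2 : downEdges G ∅ {t} = ∅ := by simp [downEdges]
    rw [h2, Finset.card_empty, Nat.cast_zero, mul_zero] at hB4
    unfold edgesIn
    linarith

end Strategy

/-! ### Survival below the threshold -/

section Survival

open Classical

variable {V : Type*} {F : SimpleGraph V} {N r : ℕ}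

lemma exists_copy_of_loses {σ : Strategy N r} {G : SimpleGraph (Fin N × Fin r)}
    (h : Loses F σ G) : ∃ τ : V → Fin N, Function.Injective τ ∧
      ∀ u w, F.Adj u w → G.Adj (τ u, choice σ G (τ u)) (τ w, choice σ G (τ w)) := by
  obtain ⟨f⟩ := h
  have hsel : ∀ u, (f u : Fin N × Fin r) = ((f u).1.1, choice σ G (f u).1.1) := by
    intro u
    obtain ⟨i, hi⟩ := (f u).2
    rw [← hi]
    rfl
  refine ⟨fun u => (f u).1.1, fun a b hab => f.injective (Subtype.ext ?_), fun u w huw => ?_⟩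
  · simp only at hab
    change (f a : Fin N × Fin r) = f b
    rw [hsel a, hsel b, hab]
  · have := f.toHom.map_adj huw
    rw [← hsel u, ← hsel w]
    exact this

variable [Fintype V]

/-- The order of positions that belongs to the given times of appearance. -/
lemma exists_vertexOrdering_of_injective {τ : V → Fin N} (hτ : Function.Injective τ) :
    ∃ π : VertexOrdering V, ∀ u w, π u < π w → τ w < τ u := by
  let τ' : V → (Fin N)ᵒᵈ := fun u => OrderDual.toDual (τ u)
  let _ : LinearOrder V := LinearOrder.lift' τ' hτ
  refine ⟨(Fintype.orderIsoFinOfCardEq V rfl).symm.toEquiv, fun u w h => ?_⟩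
  exact (Fintype.orderIsoFinOfCardEq V rfl).symm.lt_iff_lt.1 h

/-- `a` is the numerator of `mStar r F`; the excess of a sparse set of rounds is then at least
`1 / a`, whereas a copy of `F` would yield one of excess less than `1 / a`. -/
lemma not_loses_of_isSparse {G : SimpleGraph (Fin N × Fin r)} {θ θ' : ℝ} {K K₁ a b : ℕ}
    (hr : 0 < r) (ha : 0 < a) (hb : 0 < b) (hm : mStar r F = a / b) (hθ : θ = b / a)
    (hsp : IsSparse G θ (K + 1)) (hθ' : 0 ≤ θ') (hlt : θ' < θ) (hK₁ : θ' ≤ K₁ * (θ - θ'))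
    (hK : Fintype.card V + Fintype.card V * r * K₁ ≤ K)
    (hsmall : ∀ (π : VertexOrdering V) (H₁ : F.Subgraph) (Hs : V → F.Subgraph),
      (θ - θ') * weightedEdges r π H₁ Hs < 1 / a) :
    ¬ Loses F (leastDanger N hr θ' K) G := by
  intro hl
  obtain ⟨τ, hinj, hG⟩ := exists_copy_of_loses hl
  obtain ⟨π, hπ⟩ := exists_vertexOrdering_of_injective hinj
  obtain ⟨H₁, Hs, hseq, hratio⟩ := exists_mStar_le_densityRatio (F := F) r π
  have ha' : (0 : ℝ) < a := by exact_mod_cast ha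
  have hb' : (0 : ℝ) < b := by exact_mod_cast hb
  have hB1 := one_le_weightedBlocks hr hseq
  have hBE : weightedBlocks r π H₁ Hs ≤ θ * weightedEdges r π H₁ Hs := by
    rw [densityRatio_eq, hm, le_div_iff₀ (by linarith), div_mul_eq_mul_div,
      div_le_iff₀ hb'] at hratio
    rw [hθ, div_mul_eq_mul_div, le_div_iff₀ ha']
    linarith
  have hne : H₁.verts.Nonempty := by
    rw [Set.nonempty_iff_ne_empty]
    intro hempty
    have : weightedEdges r π H₁ Hs = 0 := by
      unfold weightedEdges
      exact Finset.sum_eq_zero fun u hu => by simp [hempty] at hu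
    rw [this, mul_zero] at hBE
    linarith
  obtain ⟨u₁, hu₁⟩ := exists_isYoungest π hne
  set s := choice (leastDanger N hr θ' K) G
  have hs : ∀ t j, minExcess G θ' K (t, j) ≤ minExcess G θ' K (t, s t) :=
    minExcess_le_choice hr θ' K G
  have hroot : (r : ℝ) * minExcess G θ' K (τ u₁, s (τ u₁)) ≤
      weightedBlocks r π H₁ Hs - 1 - θ' * weightedEdges r π H₁ Hs := by
    rw [← sum_coeff_mul_eq hu₁ hseq fun u => minExcess G θ' K (τ u, s (τ u))]
    unfold weightedBlocks weightedEdges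
    rw [add_sub_cancel_left, Finset.mul_sum, ← Finset.sum_sub_distrib]
    refine Finset.sum_le_sum fun u hu => ?_
    have hu' : u ∈ H₁.verts := by simpa using hu
    have h1 := minExcess_selected_le hsp hθ' hlt hK₁ hK s hs π τ hπ hG (Hs u).verts.toFinset u
      (by simpa using hseq.mem u hu') (fun w hw => hseq.avoids u hu' w (by simpa using hw)) hr
    have h2 : θ' * ((Hs u).edgeSet.ncard : ℝ) ≤ θ' * edgesWithin F π (Hs u).verts.toFinset :=
      mul_le_mul_of_nonneg_left (by exact_mod_cast ncard_edgeSet_le_edgesWithin π (Hs u)) hθ'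
    rw [Set.ncard_eq_toFinset_card']
    have h3 := coeff_nonneg hr π H₁ Hs u
    calc _ ≤ coeff r π H₁ Hs u *
          (((Hs u).verts.toFinset.card : ℝ) - 1 - θ' * ((Hs u).edgeSet.ncard : ℝ)) :=
          mul_le_mul_of_nonneg_left (by linarith) h3
      _ = _ := by ring
  have hV : 1 ≤ Fintype.card V := Fintype.card_pos_iff.2 ⟨u₁⟩
  obtain ⟨B, hBne, hBcard, hB⟩ := exists_card_sub_edgesIn_le hsp hθ' hlt hK₁ s hs (τ u₁) (K := K)
    (by nlinarith [Nat.mul_le_mul_right (r * K₁) hV])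
  have hdense : (B.card : ℝ) - θ * edgesIn G B < 1 / a := by
    have h1 := hsmall π H₁ Hs
    have h2 : θ' * (edgesIn G B : ℝ) ≤ θ * edgesIn G B :=
      mul_le_mul_of_nonneg_right hlt.le (Nat.cast_nonneg _)
    linarith
  have hpos := hsp B hBne hBcard
  rw [hθ, div_mul_eq_mul_div] at hpos hdense
  rw [div_lt_iff₀ ha'] at hpos
  rw [sub_lt_iff_lt_add, ← add_div, lt_div_iff₀ ha'] at hdense
  -- No integer lies strictly between two consecutive ones.
  have h1 : b * edgesIn G B < B.card * a := by exact_mod_cast hpos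
  have h2 : B.card * a < 1 + b * edgesIn G B := by exact_mod_cast hdense
  omega

/-- The first moment method: the union bound over all sets of at most `K` rounds and all sets of
`⌈m * k⌉` edges inside them. -/
lemma binomialRandom_real_not_isSparse_le (p : unitInterval) {m : ℝ} (hm : 0 < m) (K : ℕ)
    (hp : (N : ℝ) * (p : ℝ) ^ m ≤ 1) :
    (SimpleGraph.binomialRandom (Fin N × Fin r) p).real {G | ¬ IsSparse G (1 / m) K} ≤
      K * 2 ^ (r * K) ^ 2 * (N * (p : ℝ) ^ m) := by
  set P : Finset (Fin N) → Finset ((Fin N × Fin r) × (Fin N × Fin r)) := fun B =>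
    (verticesIn B ×ˢ verticesIn B).filter fun e => e.2.1 < e.1.1 with hP
  have hp0 : (0 : ℝ) ≤ p := p.2.1
  have hp1 : (p : ℝ) ≤ 1 := p.2.2
  have hcover : {G | ¬ IsSparse G (1 / m) K} ⊆ ⋃ k ∈ Finset.Icc 1 K,
      ⋃ B ∈ Finset.powersetCard k (Finset.univ : Finset (Fin N)),
      ⋃ D ∈ Finset.powersetCard ⌈m * k⌉₊ (P B),
        {G : SimpleGraph (Fin N × Fin r) | ∀ e ∈ D, G.Adj e.1 e.2} := by
    intro G hG
    simp only [IsSparse, Set.mem_ofPred_eq, not_forall, not_lt] at hG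
    obtain ⟨B, hne, hcard, hB⟩ := hG
    rw [one_div, ← div_eq_inv_mul, le_div_iff₀ hm, mul_comm] at hB
    obtain ⟨D, hD, hDcard⟩ := Finset.exists_subset_card_eq (Nat.ceil_le.2 hB)
    simp only [Set.mem_iUnion]
    refine ⟨B.card, Finset.mem_Icc.2 ⟨hne.card_pos, hcard⟩, B, by simp, D, ?_, ?_⟩
    · rw [Finset.mem_powersetCard]
      refine ⟨fun e he => ?_, hDcard⟩
      have := (mem_downEdges G).1 (hD he)
      simp only [hP, Finset.mem_filter, Finset.mem_product, mem_verticesIn]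
      simp only [mem_verticesIn] at this
      tauto
    · exact fun e he => ((mem_downEdges G).1 (hD he)).2.2.2
  have hverts : ∀ B : Finset (Fin N), (verticesIn B : Finset (Fin N × Fin r)).card = B.card * r := by
    intro B
    have : (verticesIn B : Finset (Fin N × Fin r)) = B ×ˢ Finset.univ := by ext; simp
    rw [this, Finset.card_product, Finset.card_univ, Fintype.card_fin]
  have hD : ∀ k ∈ Finset.Icc 1 K, ∀ B ∈ Finset.powersetCard k (Finset.univ : Finset (Fin N)),
      ∑ D ∈ Finset.powersetCard ⌈m * k⌉₊ (P B),
        (SimpleGraph.binomialRandom (Fin N × Fin r) p).real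
          {G : SimpleGraph (Fin N × Fin r) | ∀ e ∈ D, G.Adj e.1 e.2} ≤
      2 ^ (r * K) ^ 2 * ((p : ℝ) ^ m) ^ k := by
    intro k hk B hB
    have hBk := (Finset.mem_powersetCard.1 hB).2
    have h1 : ∀ D ∈ Finset.powersetCard ⌈m * k⌉₊ (P B),
        (SimpleGraph.binomialRandom (Fin N × Fin r) p).real
          {G : SimpleGraph (Fin N × Fin r) | ∀ e ∈ D, G.Adj e.1 e.2} ≤ ((p : ℝ) ^ m) ^ k := by
      intro D hD
      obtain ⟨hDP, hDcard⟩ := Finset.mem_powersetCard.1 hD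
      rw [binomialRandom_real_pairs p (τ := fun v => v.1.val), hDcard, ← Real.rpow_mul_natCast hp0,
        ← Real.rpow_natCast]
      · rcases hp0.eq_or_lt with h0 | h0
        · rw [← h0, Real.zero_rpow, Real.zero_rpow]
          · have : 0 < m * k := mul_pos hm (by exact_mod_cast (Finset.mem_Icc.1 hk).1)
            exact this.ne'
          · have : 0 < m * k := mul_pos hm (by exact_mod_cast (Finset.mem_Icc.1 hk).1)
            exact_mod_cast (Nat.ceil_pos.2 this).ne'
        · exact Real.rpow_le_rpow_of_exponent_ge h0 hp1 (Nat.le_ceil _)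
      · intro e he
        exact (Finset.mem_filter.1 (hDP he)).2
    refine (Finset.sum_le_card_nsmul _ _ _ h1).trans ?_
    rw [nsmul_eq_mul]
    refine mul_le_mul_of_nonneg_right ?_ (pow_nonneg (Real.rpow_nonneg hp0 _) _)
    have h2 : (Finset.powersetCard ⌈m * k⌉₊ (P B)).card ≤ 2 ^ (r * K) ^ 2 := by
      calc _ ≤ (P B).powerset.card := Finset.card_le_card fun D hD =>
            Finset.mem_powerset.2 (Finset.mem_powersetCard.1 hD).1
        _ = 2 ^ (P B).card := Finset.card_powerset _
        _ ≤ _ := by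
          refine Nat.pow_le_pow_right (by norm_num) ((Finset.card_filter_le _ _).trans ?_)
          rw [Finset.card_product, hverts, hBk, ← pow_two]
          refine Nat.pow_le_pow_left ?_ 2
          rw [mul_comm]
          exact Nat.mul_le_mul_left _ (Finset.mem_Icc.1 hk).2
    exact_mod_cast h2
  have hk : ∀ k ∈ Finset.Icc 1 K,
      ∑ B ∈ Finset.powersetCard k (Finset.univ : Finset (Fin N)),
        (2 : ℝ) ^ (r * K) ^ 2 * ((p : ℝ) ^ m) ^ k ≤ 2 ^ (r * K) ^ 2 * (N * (p : ℝ) ^ m) := by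
    intro k hk
    rw [Finset.sum_const, Finset.card_powersetCard, Finset.card_univ, Fintype.card_fin,
      nsmul_eq_mul, mul_left_comm]
    refine mul_le_mul_of_nonneg_left ?_ (by positivity)
    have h0 : 0 ≤ (p : ℝ) ^ m := Real.rpow_nonneg hp0 _
    calc ((N.choose k : ℕ) : ℝ) * ((p : ℝ) ^ m) ^ k ≤ (N : ℝ) ^ k * ((p : ℝ) ^ m) ^ k := by
          refine mul_le_mul_of_nonneg_right ?_ (pow_nonneg h0 _)
          exact_mod_cast Nat.choose_le_pow N k
      _ = (N * (p : ℝ) ^ m) ^ k := (mul_pow _ _ _).symm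
      _ ≤ _ := pow_le_of_le_one (by positivity) hp (by have := (Finset.mem_Icc.1 hk).1; omega)
  calc _ ≤ _ := MeasureTheory.measureReal_mono hcover (MeasureTheory.measure_ne_top _ _)
    _ ≤ ∑ k ∈ Finset.Icc 1 K, ∑ B ∈ Finset.powersetCard k (Finset.univ : Finset (Fin N)),
        ∑ D ∈ Finset.powersetCard ⌈m * k⌉₊ (P B),
          (SimpleGraph.binomialRandom (Fin N × Fin r) p).real
            {G : SimpleGraph (Fin N × Fin r) | ∀ e ∈ D, G.Adj e.1 e.2} := by
        refine (MeasureTheory.measureReal_biUnion_finset_le _ _).trans ?_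
        refine Finset.sum_le_sum fun k _ => ?_
        refine (MeasureTheory.measureReal_biUnion_finset_le _ _).trans ?_
        exact Finset.sum_le_sum fun B _ => MeasureTheory.measureReal_biUnion_finset_le _ _
    _ ≤ ∑ k ∈ Finset.Icc 1 K, 2 ^ (r * K) ^ 2 * (N * (p : ℝ) ^ m) :=
        Finset.sum_le_sum fun k hk' => (Finset.sum_le_sum (hD k hk')).trans (hk k hk')
    _ = _ := by
        rw [Finset.sum_const, Nat.card_Icc, Nat.add_sub_cancel, nsmul_eq_mul, mul_assoc]

lemma tendsto_mul_rpow_zero {m : ℝ} (hm : 0 < m) (hr : 0 < r) {p : ℕ → unitInterval}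
    (hp : (fun N : ℕ => (p (N * r) : ℝ)) =o[atTop]
      (fun N : ℕ => ((N * r : ℕ) : ℝ) ^ (-1 / m))) :
    Tendsto (fun N : ℕ => (N : ℝ) * (p (N * r) : ℝ) ^ m) atTop (𝓝 0) := by
  have h1 := hp.tendsto_div_nhds_zero
  have h2 := (h1.rpow_const (p := m) (Or.inr hm.le))
  rw [Real.zero_rpow hm.ne'] at h2
  refine squeeze_zero' (Eventually.of_forall fun N =>
    mul_nonneg (Nat.cast_nonneg _) (Real.rpow_nonneg (p _).2.1 _)) ?_ h2
  filter_upwards [eventually_ge_atTop 1] with N hN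
  have hpos : (0 : ℝ) < (N * r : ℕ) := by exact_mod_cast Nat.mul_pos hN hr
  rw [Real.div_rpow (p _).2.1 (Real.rpow_nonneg hpos.le _), ← Real.rpow_mul hpos.le,
    div_mul_cancel₀ _ hm.ne', Real.rpow_neg_one, div_inv_eq_mul, mul_comm]
  refine mul_le_mul_of_nonneg_left ?_ (Real.rpow_nonneg (p _).2.1 _)
  exact_mod_cast Nat.le_mul_of_pos_right N hr

/-- Below the threshold, the strategy of least danger a.a.s. survives. -/
theorem exists_strategy_tendsto_probSurvives (hF : F ≠ ⊥) (hr : 0 < r) {p : ℕ → unitInterval}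
    (hp : (fun N : ℕ => (p (N * r) : ℝ)) =o[atTop]
      (fun N : ℕ => ((N * r : ℕ) : ℝ) ^ (-1 / mStar r F))) :
    ∃ σ : (N : ℕ) → Strategy N r,
      Tendsto (fun N : ℕ => probSurvives F (σ N) (p (N * r))) atTop (𝓝 1) := by
  have hm := mStar_pos hr hF
  obtain ⟨q, hq⟩ := exists_ratCast_eq_mStar hr F
  have hq0 : 0 < q := by rw [hq] at hm; exact_mod_cast hm
  obtain ⟨a, ha⟩ := Int.eq_ofNat_of_zero_le (Rat.num_nonneg.2 hq0.le)
  have ha0 : 0 < a := by have := Rat.num_pos.2 hq0; omega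
  have hmab : mStar r F = a / q.den := by
    rw [hq]
    conv_lhs => rw [← Rat.num_div_den q, ha]
    push_cast
    rfl
  have ha' : (0 : ℝ) < a := by exact_mod_cast ha0
  have hb' : (0 : ℝ) < q.den := by exact_mod_cast q.den_pos
  obtain ⟨W, hW⟩ : ∃ W : ℝ, ∀ (π : VertexOrdering V) (H₁ : F.Subgraph) (Hs : V → F.Subgraph),
      weightedEdges r π H₁ Hs ≤ W := by
    obtain ⟨W, hW⟩ := (Set.finite_range fun x : VertexOrdering V × F.Subgraph × (V → F.Subgraph) =>
      weightedEdges r x.1 x.2.1 x.2.2).bddAbove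
    exact ⟨W, fun π H₁ Hs => hW ⟨(π, H₁, Hs), rfl⟩⟩
  set θ : ℝ := 1 / mStar r F with hθ
  have hθab : θ = q.den / a := by rw [hθ, hmab, one_div_div]
  have hθ0 : 0 < θ := by positivity
  -- The gap `ε = θ - θ'` is so small that it cannot make up for an excess of `1 / a`.
  obtain ⟨ε, hε0, hε1, hε2⟩ : ∃ ε : ℝ, 0 < ε ∧ ε ≤ θ ∧ ε * (|W| + 1) < 1 / a := by
    have h0 : 0 < 1 / (a : ℝ) / (|W| + 1) / 2 := by positivity
    refine ⟨min θ (1 / (a : ℝ) / (|W| + 1) / 2), lt_min hθ0 h0, min_le_left _ _, ?_⟩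
    calc _ ≤ (1 / (a : ℝ) / (|W| + 1) / 2) * (|W| + 1) :=
          mul_le_mul_of_nonneg_right (min_le_right _ _) (by positivity)
      _ = 1 / (a : ℝ) / 2 := by field_simp
      _ < _ := half_lt_self (by positivity)
  obtain ⟨K₁, hK₁⟩ := exists_nat_ge ((θ - ε) / ε)
  rw [div_le_iff₀ hε0] at hK₁
  set K := Fintype.card V + Fintype.card V * r * K₁ with hK
  refine ⟨fun N => leastDanger N hr (θ - ε) K, ?_⟩
  have hlim := tendsto_mul_rpow_zero hm hr hp
  have hreal : Tendsto (fun N : ℕ => (probSurvives F (leastDanger N hr (θ - ε) K)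
      (p (N * r))).toReal) atTop (𝓝 1) := by
    have hlow : Tendsto (fun N : ℕ => 1 - ((K + 1 : ℕ) : ℝ) * 2 ^ (r * (K + 1)) ^ 2 *
        (N * (p (N * r) : ℝ) ^ mStar r F)) atTop (𝓝 1) := by
      simpa using (tendsto_const_nhds (x := (1 : ℝ))).sub (hlim.const_mul
        (((K + 1 : ℕ) : ℝ) * 2 ^ (r * (K + 1)) ^ 2))
    refine tendsto_of_tendsto_of_tendsto_of_le_of_le' hlow tendsto_const_nhds ?_
      (Eventually.of_forall fun N => MeasureTheory.measureReal_le_one)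
    filter_upwards [hlim.eventually_le_const zero_lt_one] with N hN
    have h1 := binomialRandom_real_not_isSparse_le (r := r) (p (N * r)) hm (K + 1) hN
    have h2 : (SimpleGraph.binomialRandom (Fin N × Fin r) (p (N * r))).real Set.univ ≤
        (SimpleGraph.binomialRandom (Fin N × Fin r) (p (N * r))).real
          {G | ¬ Loses F (leastDanger N hr (θ - ε) K) G} +
        (SimpleGraph.binomialRandom (Fin N × Fin r) (p (N * r))).real
          {G | ¬ IsSparse G (1 / mStar r F) (K + 1)} := by
      refine (MeasureTheory.measureReal_mono fun G _ => ?_).trans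
        (MeasureTheory.measureReal_union_le _ _)
      by_cases hsp : IsSparse G (1 / mStar r F) (K + 1)
      · refine Or.inl (not_loses_of_isSparse hr ha0 q.den_pos hmab hθab hsp (by linarith)
          (by linarith) (by simpa using hK₁) le_rfl fun π H₁ Hs => ?_)
        rw [sub_sub_cancel]
        refine lt_of_le_of_lt (mul_le_mul_of_nonneg_left ?_ hε0.le) hε2
        linarith [hW π H₁ Hs, le_abs_self W]
      · exact Or.inr hsp
    rw [MeasureTheory.measureReal_def, MeasureTheory.measure_univ, ENNReal.toReal_one] at h2
    have h3 : (probSurvives F (leastDanger N hr (θ - ε) K) (p (N * r))).toReal =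
      (SimpleGraph.binomialRandom (Fin N × Fin r) (p (N * r))).real
          {G | ¬ Loses F (leastDanger N hr (θ - ε) K) G} := rfl
    rw [h3]
    linarith
  have := ENNReal.tendsto_ofReal hreal
  rw [ENNReal.ofReal_one] at this
  refine this.congr fun N => ENNReal.ofReal_toReal (MeasureTheory.measure_ne_top _ _)

end Survival

/-! ### Optimal threats -/

section Threat

open Classical

variable {V : Type*} [Fintype V] {F : SimpleGraph V}

/-- The vertex sets that contain `u` and no younger vertex. -/
def admissible (π : VertexOrdering V) (u : V) : Finset (Finset V) :=
  Finset.univ.filter fun S => u ∈ S ∧ ∀ w ∈ S, π u ≤ π w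

lemma mem_admissible {π : VertexOrdering V} {u : V} {S : Finset V} :
    S ∈ admissible π u ↔ u ∈ S ∧ ∀ w ∈ S, π u ≤ π w := by simp [admissible]

lemma singleton_mem_admissible (π : VertexOrdering V) (u : V) : {u} ∈ admissible π u := by
  simp [mem_admissible]

/-- The least cost of a threat at a vertex that plays the role of `u`. The threat is a vertex set
`S` with youngest vertex `u`; every other vertex `w` of `S` costs `1` for its round, and must have
been forced, i.e. each of its `r - 1` competitors was under an optimal threat as well. If
`p = n ^ (-θ)`, then `n` to the power of the cost is the order of the expected number of such
threats at a given vertex. -/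
def threat (F : SimpleGraph V) (r : ℕ) (θ : ℝ) (π : VertexOrdering V) (u : V) : ℝ :=
  (admissible π u).inf' ⟨_, singleton_mem_admissible π u⟩ fun S =>
    ∑ w : {w : V // w ∈ S ∧ π u < π w}, (1 + (r - 1) * threat F r θ π w.1) -
      θ * edgesWithin F π S
termination_by Fintype.card V - (π u).val
decreasing_by
  have h := w.2.2
  rw [Fin.lt_def] at h
  have := (π w.1).isLt
  omega

/-- The cost of a vertex `w` and of optimal threats at its competitors. -/
def forcedCost (F : SimpleGraph V) (r : ℕ) (θ : ℝ) (π : VertexOrdering V) (w : V) : ℝ :=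
  1 + (r - 1) * threat F r θ π w

/-- The cost of a forced copy of a vertex set. -/
def copyCost (F : SimpleGraph V) (r : ℕ) (θ : ℝ) (π : VertexOrdering V) (S : Finset V) : ℝ :=
  ∑ w ∈ S, forcedCost F r θ π w - θ * edgesWithin F π S

variable {r : ℕ} {θ : ℝ} {π : VertexOrdering V}

lemma copyCost_sub_eq {u : V} {S : Finset V} (hS : S ∈ admissible π u) :
    copyCost F r θ π S - forcedCost F r θ π u =
      ∑ w : {w : V // w ∈ S ∧ π u < π w}, (1 + (r - 1) * threat F r θ π w.1) -
        θ * edgesWithin F π S := by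
  obtain ⟨h1, h2⟩ := mem_admissible.1 hS
  have : ∑ w : {w : V // w ∈ S ∧ π u < π w}, (1 + (r - 1) * threat F r θ π w.1) =
      ∑ w ∈ S.erase u, forcedCost F r θ π w := by
    symm
    refine Finset.sum_subtype (S.erase u) (fun w => ?_) (forcedCost F r θ π)
    rw [Finset.mem_erase]
    constructor
    · rintro ⟨h3, h4⟩
      exact ⟨h4, lt_of_le_of_ne (h2 w h4) fun h => h3 (π.injective h.symm)⟩
    · rintro ⟨h3, h4⟩
      exact ⟨by rintro rfl; exact lt_irrefl _ h4, h3⟩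
  rw [this, copyCost, ← Finset.add_sum_erase S _ h1]
  ring

lemma threat_le {u : V} {S : Finset V} (hS : S ∈ admissible π u) :
    threat F r θ π u ≤ copyCost F r θ π S - forcedCost F r θ π u := by
  rw [copyCost_sub_eq hS, threat]
  exact Finset.inf'_le (fun S => ∑ w : {w : V // w ∈ S ∧ π u < π w},
    (1 + (r - 1) * threat F r θ π w.1) - θ * edgesWithin F π S) hS

lemma exists_threat_eq (F : SimpleGraph V) (r : ℕ) (θ : ℝ) (π : VertexOrdering V) (u : V) :
    ∃ S ∈ admissible π u, threat F r θ π u = copyCost F r θ π S - forcedCost F r θ π u := by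
  obtain ⟨S, hS, h⟩ := Finset.exists_mem_eq_inf' ⟨_, singleton_mem_admissible π u⟩
    fun S => ∑ w : {w : V // w ∈ S ∧ π u < π w}, (1 + (r - 1) * threat F r θ π w.1) -
      θ * edgesWithin F π S
  exact ⟨S, hS, by rw [copyCost_sub_eq hS, threat, h]⟩

lemma exists_maximal_threat_eq (F : SimpleGraph V) (r : ℕ) (θ : ℝ) (π : VertexOrdering V)
    (u : V) : ∃ S ∈ admissible π u,
      threat F r θ π u = copyCost F r θ π S - forcedCost F r θ π u ∧
      ∀ S' ∈ admissible π u, copyCost F r θ π S' - forcedCost F r θ π u ≤ threat F r θ π u →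
        S'.card ≤ S.card := by
  obtain ⟨S₀, h1, h2⟩ := exists_threat_eq F r θ π u
  obtain ⟨S, hS, hmax⟩ := Finset.exists_max_image ((admissible π u).filter fun S =>
    threat F r θ π u = copyCost F r θ π S - forcedCost F r θ π u) Finset.card
    ⟨S₀, Finset.mem_filter.2 ⟨h1, h2⟩⟩
  rw [Finset.mem_filter] at hS
  exact ⟨S, hS.1, hS.2, fun S' h h' =>
    hmax S' (Finset.mem_filter.2 ⟨h, le_antisymm (threat_le h) h'⟩)⟩

lemma edgesWithin_supermodular (F : SimpleGraph V) (π : VertexOrdering V) (A B : Finset V) :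
    edgesWithin F π A + edgesWithin F π B ≤ edgesWithin F π (A ∪ B) + edgesWithin F π (A ∩ B) := by
  unfold edgesWithin
  rw [← Finset.card_union_add_card_inter]
  refine Nat.add_le_add (Finset.card_le_card fun e he => ?_) (Finset.card_le_card fun e he => ?_)
  · simp only [Finset.mem_union, Finset.mem_filter, Finset.mem_univ, true_and] at he ⊢
    tauto
  · simp only [Finset.mem_inter, Finset.mem_filter, Finset.mem_univ, true_and] at he ⊢
    tauto

lemma copyCost_submodular (hθ : 0 ≤ θ) (A B : Finset V) :
    copyCost F r θ π (A ∪ B) + copyCost F r θ π (A ∩ B) ≤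
      copyCost F r θ π A + copyCost F r θ π B := by
  unfold copyCost
  have h1 := Finset.sum_union_inter (s₁ := A) (s₂ := B) (f := forcedCost F r θ π)
  have h2 : θ * ((edgesWithin F π A : ℝ) + edgesWithin F π B) ≤
      θ * (edgesWithin F π (A ∪ B) + edgesWithin F π (A ∩ B)) :=
    mul_le_mul_of_nonneg_left (by exact_mod_cast edgesWithin_supermodular F π A B) hθ
  linarith

/-- Uncrossing: the largest optimal threats are nested, so they form an admissible sequence of
subgraphs. -/
lemma subset_of_maximal_threat (hθ : 0 ≤ θ) {u w : V} {A B : Finset V}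
    (hA : A ∈ admissible π u)
    (hAeq : threat F r θ π u = copyCost F r θ π A - forcedCost F r θ π u)
    (hAmax : ∀ S ∈ admissible π u,
      copyCost F r θ π S - forcedCost F r θ π u ≤ threat F r θ π u → S.card ≤ A.card)
    (hw : w ∈ A) (hB : B ∈ admissible π w)
    (hBeq : threat F r θ π w = copyCost F r θ π B - forcedCost F r θ π w) : B ⊆ A := by
  rw [mem_admissible] at hA hB
  have h1 : A ∪ B ∈ admissible π u := by
    rw [mem_admissible]
    refine ⟨Finset.mem_union_left _ hA.1, fun x hx => ?_⟩
    rcases Finset.mem_union.1 hx with hx | hx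
    · exact hA.2 x hx
    · exact (hA.2 w hw).trans (hB.2 x hx)
  have h2 : A ∩ B ∈ admissible π w := by
    rw [mem_admissible]
    exact ⟨Finset.mem_inter.2 ⟨hw, hB.1⟩, fun x hx => hB.2 x (Finset.mem_inter.1 hx).2⟩
  have h3 := threat_le (F := F) (r := r) (θ := θ) h2
  have h4 := copyCost_submodular (F := F) (r := r) (π := π) hθ A B
  have h5 := hAmax _ h1 (by linarith)
  rw [Finset.eq_of_subset_of_card_le Finset.subset_union_left h5]
  exact Finset.subset_union_right

/-- A round in which all the `r` vertices are under an optimal threat has nonnegative cost. -/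
lemma one_add_mul_threat_nonneg (hr : 1 ≤ r) (hθ : 0 ≤ θ)
    (hmax : ∀ (H₁ : F.Subgraph) (Hs : V → F.Subgraph), IsSubgraphSequence π H₁ Hs →
      θ * weightedEdges r π H₁ Hs ≤ weightedBlocks r π H₁ Hs) (u : V) :
    0 ≤ 1 + r * threat F r θ π u := by
  choose S hSadm hSeq hSmax using exists_maximal_threat_eq F r θ π
  have hadm := fun x => mem_admissible.1 (hSadm x)
  have hnest : ∀ x, ∀ w ∈ S x, S w ⊆ S x := fun x w hw =>
    subset_of_maximal_threat hθ (hSadm x) (hSeq x) (hSmax x) hw (hSadm w) (hSeq w)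
  set H₁ : F.Subgraph := (⊤ : F.Subgraph).induce (S u) with hH₁
  set Hs : V → F.Subgraph := fun x => (⊤ : F.Subgraph).induce (S x) with hHs
  have hy : IsYoungest π H₁ u := ⟨by simpa [hH₁] using (hadm u).1, fun w hw =>
    (hadm u).2 w (by simpa [hH₁] using hw)⟩
  have hseq : IsSubgraphSequence π H₁ Hs := by
    refine ⟨fun x hx => ?_, fun x hx => ?_, fun x _ w hw => ?_, fun x _ => ?_⟩
    · rw [hx.eq hy]
    · exact SimpleGraph.Subgraph.induce_mono_right
        (by exact_mod_cast hnest u x (by simpa [hH₁] using hx))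
    · exact (hadm x).2 w (by simpa [hHs] using hw)
    · simpa [hHs] using (hadm x).1
  have hverts : ∀ x, (Hs x).verts.toFinset = S x := by intro x; ext; simp [hHs]
  have hsum : weightedBlocks r π H₁ Hs - 1 - θ * weightedEdges r π H₁ Hs ≤
      r * threat F r θ π u := by
    rw [← sum_coeff_mul_eq hy hseq (threat F r θ π)]
    unfold weightedBlocks weightedEdges
    rw [add_sub_cancel_left, Finset.mul_sum, ← Finset.sum_sub_distrib]
    refine Finset.sum_le_sum fun x _ => ?_
    have h1 : (edgesWithin F π (S x) : ℝ) ≤ (Hs x).edgeSet.ncard := by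
      exact_mod_cast edgesWithin_le_ncard_edgeSet_induce π (S x)
    have h2 : threat F r θ π x - (r - 1) * ∑ w ∈ (S x).erase x, threat F r θ π w =
        (S x).card - 1 - θ * edgesWithin F π (S x) := by
      have h3 := hSeq x
      rw [copyCost, ← Finset.add_sum_erase _ _ (hadm x).1] at h3
      have h4 : ∑ w ∈ (S x).erase x, forcedCost F r θ π w =
          ((S x).card - 1) + (r - 1) * ∑ w ∈ (S x).erase x, threat F r θ π w := by
        simp only [forcedCost]
        rw [Finset.sum_add_distrib, ← Finset.mul_sum, Finset.sum_const, nsmul_eq_mul, mul_one,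
          Finset.card_erase_of_mem (hadm x).1,
          Nat.cast_sub (Finset.card_pos.2 ⟨_, (hadm x).1⟩), Nat.cast_one]
      rw [h4] at h3
      linarith
    rw [hverts, h2, Set.ncard_eq_toFinset_card', hverts]
    have h5 := mul_le_mul_of_nonneg_left h1 hθ
    calc _ = coeff r π H₁ Hs x * (((S x).card : ℝ) - 1 - θ * ((Hs x).edgeSet.ncard : ℝ)) := by ring
      _ ≤ _ := mul_le_mul_of_nonneg_left (by linarith) (coeff_nonneg hr _ _ _ _)
  have := hmax H₁ Hs hseq
  linarith

lemma copyCost_nonneg (hr : ∀ u, 0 ≤ 1 + r * threat F r θ π u) (S : Finset V) :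
    0 ≤ copyCost F r θ π S := by
  rcases S.eq_empty_or_nonempty with rfl | hne
  · simp [copyCost, edgesWithin]
  · obtain ⟨u, hu, hmin⟩ := Finset.exists_min_image S π hne
    have h1 := threat_le (F := F) (r := r) (θ := θ) (mem_admissible.2 ⟨hu, hmin⟩)
    have h2 := hr u
    unfold forcedCost at h1
    linarith

lemma edgesWithin_insert (F : SimpleGraph V) {u : V} {S : Finset V} (hS : ∀ w ∈ S, π u < π w) :
    edgesWithin F π (insert u S) = edgesWithin F π S + (S.filter fun w => F.Adj u w).card := by
  unfold edgesWithin
  have hinj : Function.Injective fun w : V => (u, w) := fun a b h => by simpa using h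
  rw [← Finset.card_image_of_injective (S.filter fun w => F.Adj u w) hinj,
    ← Finset.card_union_of_disjoint]
  · congr 1
    ext ⟨x, y⟩
    simp only [Finset.mem_filter, Finset.mem_univ, true_and, Finset.mem_insert, Finset.mem_union,
      Finset.mem_image, Prod.mk.injEq]
    constructor
    · rintro ⟨rfl | hx, rfl | hy, hlt, hadj⟩
      · exact absurd hlt (lt_irrefl _)
      · exact Or.inr ⟨y, ⟨hy, hadj⟩, rfl, rfl⟩
      · exact absurd hlt (lt_asymm (hS x hx))
      · exact Or.inl ⟨hx, hy, hlt, hadj⟩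
    · rintro (⟨hx, hy, hlt, hadj⟩ | ⟨w, ⟨hw, hadj⟩, rfl, rfl⟩)
      · exact ⟨Or.inr hx, Or.inr hy, hlt, hadj⟩
      · exact ⟨Or.inl rfl, Or.inr hw, hS _ hw, hadj⟩
  · rw [Finset.disjoint_left]
    rintro ⟨x, y⟩ h h'
    simp only [Finset.mem_filter, Finset.mem_univ, true_and, Finset.mem_image, Prod.mk.injEq] at h h'
    obtain ⟨w, -, rfl, rfl⟩ := h'
    exact lt_irrefl _ (hS _ h.1)

lemma copyCost_insert {u : V} {S : Finset V} (hS : ∀ w ∈ S, π u < π w) :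
    copyCost F r θ π (insert u S) = forcedCost F r θ π u + copyCost F r θ π S -
      θ * (S.filter fun w => F.Adj u w).card := by
  unfold copyCost
  rw [edgesWithin_insert F hS, Finset.sum_insert fun h => lt_irrefl _ (hS u h)]
  push_cast
  ring

/-! ### The tree of rounds that forces a copy -/

/-!
The rounds of the tree are the words over `Fin r` of length less than the number of vertices of
`F`. The last letter added is at the head, so the round `a :: x` is the child of the vertex `a` of
the round `x`. In each round `x` the vertex `s x` is selected. The vertex `a` of the round `x`, of
length `i`, is joined to the selected vertices of the rounds on the path that starts at `a :: x`
and follows the selected vertices, in the way in which the vertex of `F` at position `i` is joined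
to the later positions.
-/

/-- The next round on the path of selected vertices. -/
def nextRound (s : List (Fin r) → Fin r) (x : List (Fin r)) : List (Fin r) := s x :: x

lemma length_iterate_nextRound (s : List (Fin r) → Fin r) (k : ℕ) (x : List (Fin r)) :
    ((nextRound s)^[k] x).length = x.length + k := by
  induction k generalizing x with
  | zero => rfl
  | succ k ih => rw [Function.iterate_succ_apply, ih, nextRound, List.length_cons]; omega

/-- The round on the path from `x` that hosts the vertex `u` of `F`, i.e. the one whose length is
the position of `u`; only meaningful if this position is at least the length of `x`. -/
def hostRound (π : VertexOrdering V) (s : List (Fin r) → Fin r) (x : List (Fin r)) (u : V) :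
    List (Fin r) := (nextRound s)^[(π u).val - x.length] x

lemma length_hostRound {s : List (Fin r) → Fin r} {x : List (Fin r)} {u : V}
    (h : x.length ≤ (π u).val) : (hostRound π s x u).length = (π u).val := by
  rw [hostRound, length_iterate_nextRound]; omega

lemma hostRound_nextRound {s : List (Fin r) → Fin r} {x : List (Fin r)} {u : V}
    (h : x.length < (π u).val) : hostRound π s (s x :: x) u = hostRound π s x u := by
  unfold hostRound
  obtain ⟨k, hk⟩ : ∃ k, (π u).val - x.length = k + 1 := ⟨(π u).val - x.length - 1, by omega⟩
  rw [hk, Function.iterate_succ_apply, List.length_cons, ← Nat.sub_sub, hk]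
  rfl

lemma hostRound_of_eq {s : List (Fin r) → Fin r} {x : List (Fin r)} {u : V}
    (h : (π u).val = x.length) : hostRound π s x u = x := by
  simp [hostRound, h]

/-- The vertices of `F` hosted, on the path from `x`, by the rounds in `B`. -/
def hosted (π : VertexOrdering V) (s : List (Fin r) → Fin r) (B : Finset (List (Fin r)))
    (x : List (Fin r)) : Finset V :=
  Finset.univ.filter fun u => x.length ≤ (π u).val ∧ hostRound π s x u ∈ B

lemma mem_hosted {s : List (Fin r) → Fin r} {B : Finset (List (Fin r))} {x : List (Fin r)}
    {u : V} : u ∈ hosted π s B x ↔ x.length ≤ (π u).val ∧ hostRound π s x u ∈ B := by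
  simp [hosted]

lemma hosted_eq_insert {s : List (Fin r) → Fin r} {B : Finset (List (Fin r))} {x : List (Fin r)}
    {u : V} (hu : (π u).val = x.length) :
    hosted π s B x = if x ∈ B then insert u (hosted π s B (s x :: x))
      else hosted π s B (s x :: x) := by
  have key : ∀ w, w ∈ hosted π s B x ↔ (w = u ∧ x ∈ B) ∨ w ∈ hosted π s B (s x :: x) := by
    intro w
    rw [mem_hosted, mem_hosted, List.length_cons]
    by_cases hw : w = u
    · subst hw
      rw [hostRound_of_eq hu]
      constructor
      · exact fun h => Or.inl ⟨rfl, h.2⟩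
      · rintro (h | h)
        · exact ⟨hu.ge, h.2⟩
        · omega
    · have hne : (π w).val ≠ x.length := fun h => hw (π.injective (Fin.ext (h.trans hu.symm)))
      constructor
      · rintro ⟨h1, h2⟩
        have hlt : x.length < (π w).val := lt_of_le_of_ne h1 hne.symm
        exact Or.inr ⟨hlt, by rwa [hostRound_nextRound hlt]⟩
      · rintro (h | ⟨h1, h2⟩)
        · exact absurd h.1 hw
        · exact ⟨by omega, by rwa [hostRound_nextRound h1] at h2⟩
  ext w
  rw [key]
  split_ifs with h <;> simp [h]

/-- The number of edges of the tree that go down from the vertex `a` of the round `x` to rounds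
in `B`. -/
def treeDegree (F : SimpleGraph V) (π : VertexOrdering V) (s : List (Fin r) → Fin r)
    (B : Finset (List (Fin r))) (x : List (Fin r)) (a : Fin r) : ℕ :=
  ((hosted π s B (a :: x)).filter fun w => ∃ u, (π u).val = x.length ∧ F.Adj u w).card

/-- The rounds of `B` below `x`. -/
def below (B : Finset (List (Fin r))) (x : List (Fin r)) : Finset (List (Fin r)) :=
  B.filter fun y => x <:+ y

lemma suffix_iff_eq_or_exists_cons_suffix {α : Type*} {x y : List α} :
    x <:+ y ↔ y = x ∨ ∃ a, a :: x <:+ y := by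
  constructor
  · rintro ⟨t, rfl⟩
    rcases List.eq_nil_or_concat t with rfl | ⟨t', a, rfl⟩
    · exact Or.inl rfl
    · exact Or.inr ⟨a, t', by simp⟩
  · rintro (rfl | ⟨a, h⟩)
    · exact List.suffix_rfl
    · exact (List.suffix_cons a x).trans h

lemma sum_below (B : Finset (List (Fin r))) (x : List (Fin r)) (f : List (Fin r) → ℝ) :
    ∑ y ∈ below B x, f y = (if x ∈ B then f x else 0) + ∑ a, ∑ y ∈ below B (a :: x), f y := by
  have hset : below B x = (B.filter fun y => y = x) ∪
      Finset.univ.biUnion fun a => below B (a :: x) := by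
    ext y
    simp only [below, Finset.mem_filter, Finset.mem_union, Finset.mem_biUnion, Finset.mem_univ,
      true_and, suffix_iff_eq_or_exists_cons_suffix (x := x)]
    constructor
    · rintro ⟨h, h' | ⟨a, h'⟩⟩
      · exact Or.inl ⟨h, h'⟩
      · exact Or.inr ⟨a, h, h'⟩
    · rintro (⟨h, h'⟩ | ⟨a, h, h'⟩)
      · exact ⟨h, Or.inl h'⟩
      · exact ⟨h, Or.inr ⟨a, h'⟩⟩
  have hlen : ∀ y a, y ∈ below B (a :: x) → x.length < y.length := fun y a hy => by
    have := (Finset.mem_filter.1 hy).2.length_le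
    simpa using this
  rw [hset, Finset.sum_union, Finset.sum_biUnion]
  · congr 1
    rw [Finset.sum_filter, Finset.sum_ite_eq' B x f]
  · intro a _ b _ hab
    rw [Function.onFun, Finset.disjoint_left]
    intro y hy hy'
    have h1 := (Finset.mem_filter.1 hy).2
    have h2 := (Finset.mem_filter.1 hy').2
    have h3 := List.suffix_of_suffix_length_le h1 h2 (by simp)
    have h4 := h3.eq_of_length (by simp)
    exact hab (List.cons.inj h4).1
  · rw [Finset.disjoint_left]
    intro y hy hy'
    obtain ⟨a, -, ha⟩ := Finset.mem_biUnion.1 hy'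
    have := hlen y a ha
    rw [(Finset.mem_filter.1 hy).2] at this
    exact lt_irrefl _ this

/-- The rounds of `B` below `x` cost at least as much as the forced copy hosted by `B` on the path
that starts at `x`: below every competitor of a vertex of this copy, `B` contains no more than an
optimal threat. -/
lemma copyCost_hosted_le (hr1 : 1 ≤ r) (hr : ∀ u, 0 ≤ 1 + r * threat F r θ π u)
    (s : List (Fin r) → Fin r) (B : Finset (List (Fin r)))
    (hB : ∀ x ∈ B, x.length < Fintype.card V) (x : List (Fin r)) :
    copyCost F r θ π (hosted π s B x) ≤
      ∑ y ∈ below B x, (1 - θ * ∑ a, (treeDegree F π s B y a : ℝ)) := by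
  induction hk : Fintype.card V - x.length generalizing x with
  | zero =>
    have h1 : hosted π s B x = ∅ := by
      refine Finset.eq_empty_of_forall_notMem fun u hu => ?_
      have := (mem_hosted.1 hu).1
      have := (π u).isLt
      omega
    have h2 : below B x = ∅ := by
      refine Finset.eq_empty_of_forall_notMem fun y hy => ?_
      obtain ⟨hy, hxy⟩ := Finset.mem_filter.1 hy
      have := hB y hy
      have := hxy.length_le
      omega
    rw [h1, h2]
    simp [copyCost, edgesWithin]
  | succ k ih =>
    have hlt : x.length < Fintype.card V := by omega
    set u := π.symm ⟨x.length, hlt⟩ with hu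
    have hpu : (π u).val = x.length := by simp [hu]
    have hih : ∀ a, copyCost F r θ π (hosted π s B (a :: x)) ≤
        ∑ y ∈ below B (a :: x), (1 - θ * ∑ a, (treeDegree F π s B y a : ℝ)) :=
      fun a => ih (a :: x) (by rw [List.length_cons]; omega)
    rw [sum_below]
    by_cases hx : x ∈ B
    · rw [hosted_eq_insert hpu, if_pos hx, if_pos hx]
      have hlater : ∀ a, ∀ w ∈ hosted π s B (a :: x), π u < π w := by
        intro a w hw
        have := (mem_hosted.1 hw).1
        rw [List.length_cons] at this
        rw [Fin.lt_def]
        omega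
      have hdeg : ∀ a, treeDegree F π s B x a =
          ((hosted π s B (a :: x)).filter fun w => F.Adj u w).card := by
        intro a
        unfold treeDegree
        congr 1
        refine Finset.filter_congr fun w _ => ?_
        constructor
        · rintro ⟨u', h1, h2⟩
          rwa [← show u' = u from π.injective (Fin.ext (h1.trans hpu.symm))]
        · exact fun h => ⟨u, hpu, h⟩
      -- Together with `u`, what `B` hosts below the vertex `a` is a threat at this vertex.
      have hthreat : ∀ a, threat F r θ π u ≤ copyCost F r θ π (hosted π s B (a :: x)) -
          θ * treeDegree F π s B x a := by
        intro a
        have hadm : insert u (hosted π s B (a :: x)) ∈ admissible π u := by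
          rw [mem_admissible]
          refine ⟨Finset.mem_insert_self _ _, fun w hw => ?_⟩
          rcases Finset.mem_insert.1 hw with rfl | hw
          · exact le_rfl
          · exact (hlater a w hw).le
        have := threat_le (F := F) (r := r) (θ := θ) hadm
        rw [copyCost_insert (hlater a), ← hdeg a] at this
        linarith
      rw [copyCost_insert (hlater (s x)), ← hdeg]
      have hsum : (r - 1) * threat F r θ π u + (copyCost F r θ π (hosted π s B (s x :: x)) -
          θ * treeDegree F π s B x (s x)) ≤
          ∑ a, (copyCost F r θ π (hosted π s B (a :: x)) - θ * treeDegree F π s B x a) := by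
        rw [← Finset.sum_erase_add _ _ (Finset.mem_univ (s x))]
        refine add_le_add ?_ le_rfl
        have h1 := Finset.card_nsmul_le_sum (Finset.univ.erase (s x))
          (fun a => copyCost F r θ π (hosted π s B (a :: x)) - θ * treeDegree F π s B x a) _
          fun a _ => hthreat a
        rw [Finset.card_erase_of_mem (Finset.mem_univ _), Finset.card_univ, Fintype.card_fin,
          nsmul_eq_mul, Nat.cast_sub hr1, Nat.cast_one] at h1
        exact h1
      have hsum' := Finset.sum_le_sum fun a (_ : a ∈ Finset.univ) => hih a
      rw [Finset.sum_sub_distrib, ← Finset.mul_sum] at hsum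
      unfold forcedCost
      linarith
    · rw [hosted_eq_insert hpu, if_neg hx, if_neg hx, zero_add]
      refine (hih (s x)).trans ?_
      refine Finset.single_le_sum (f := fun a =>
        ∑ y ∈ below B (a :: x), (1 - θ * ∑ a, (treeDegree F π s B y a : ℝ))) (fun a _ => ?_)
        (Finset.mem_univ (s x))
      exact (copyCost_nonneg hr _).trans (hih a)

/-- Every set of rounds of the tree spans at most `m` times as many edges as it has rounds, if no
sequence of subgraphs has a ratio exceeding `m`. -/
lemma sum_treeDegree_le {m : ℝ} (hm : 0 < m) (hr : 1 ≤ r)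
    (hmax : ∀ (H₁ : F.Subgraph) (Hs : V → F.Subgraph), IsSubgraphSequence π H₁ Hs →
      densityRatio r π H₁ Hs ≤ m)
    (s : List (Fin r) → Fin r) (B : Finset (List (Fin r)))
    (hB : ∀ x ∈ B, x.length < Fintype.card V) :
    ((∑ x ∈ B, ∑ a, treeDegree F π s B x a : ℕ) : ℝ) ≤ m * B.card := by
  have hmax' : ∀ (H₁ : F.Subgraph) (Hs : V → F.Subgraph), IsSubgraphSequence π H₁ Hs →
      1 / m * weightedEdges r π H₁ Hs ≤ weightedBlocks r π H₁ Hs := by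
    intro H₁ Hs hs
    have := hmax H₁ Hs hs
    rw [densityRatio_eq, div_le_iff₀ (zero_lt_one.trans_le (one_le_weightedBlocks hr hs))] at this
    rw [one_div, inv_mul_le_iff₀ hm]
    exact this
  have h0 := one_add_mul_threat_nonneg hr (one_div_nonneg.2 hm.le) hmax'
  have h1 := (copyCost_nonneg h0 _).trans (copyCost_hosted_le hr h0 s B hB [])
  have h2 : below B [] = B := by
    unfold below
    exact Finset.filter_true_of_mem fun x _ => List.nil_suffix
  rw [h2, Finset.sum_sub_distrib, Finset.sum_const, nsmul_eq_mul, mul_one, ← Finset.mul_sum,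
    sub_nonneg, one_div, inv_mul_le_iff₀ hm] at h1
  push_cast
  exact h1

end Threat

/-! ### Embeddings of the tree into the game -/

section Embedding

open Classical

variable {V : Type*} [Fintype V] {F : SimpleGraph V} {π : VertexOrdering V} {r M N : ℕ}

/-- The rounds of the tree. -/
abbrev Word (V : Type*) [Fintype V] (r : ℕ) : Type :=
  {x : List (Fin r) // x.length < Fintype.card V}

instance : Finite (Word V r) := (List.finite_length_lt (Fin r) (Fintype.card V)).to_subtype

instance : Fintype (Word V r) := Fintype.ofFinite _

/-- A function on the rounds of the tree, extended to all words by its value at the root. -/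
def extend [Nonempty V] {α : Type*} (f : Word V r → α) (x : List (Fin r)) : α :=
  if h : x.length < Fintype.card V then f ⟨x, h⟩ else f ⟨[], Fintype.card_pos⟩

lemma extend_of_lt [Nonempty V] {α : Type*} (f : Word V r → α) {x : List (Fin r)}
    (h : x.length < Fintype.card V) : extend f x = f ⟨x, h⟩ := dif_pos h

/-- Every round of the tree gets `M` rounds of the game in which it may be placed. These slots are
disjoint, and those of a round of the tree come after those of the rounds below it. -/
structure Schedule (V : Type*) [Fintype V] (r M N : ℕ) where
  /-- The slots of a word. -/
  slot : List (Fin r) → Fin M → Fin N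
  injective : ∀ x y i j, x.length < Fintype.card V → y.length < Fintype.card V →
    slot x i = slot y j → x = y ∧ i = j
  lt_of_suffix : ∀ x y i j, y.length < Fintype.card V → x <:+ y → x ≠ y → slot y i < slot x j

/-- The position of a word in the breadth-first numbering of the `r`-ary tree. -/
def heapIndex : List (Fin r) → ℕ
  | [] => 0
  | a :: x => r * heapIndex x + a + 1

lemma heapIndex_injective : Function.Injective (heapIndex (r := r)) := by
  intro x
  induction x with
  | nil =>
    intro y h
    cases y with
    | nil => rfl
    | cons b y => simp [heapIndex] at h
  | cons a x ih =>
    intro y h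
    cases y with
    | nil => simp [heapIndex] at h
    | cons b y =>
      simp only [heapIndex, Nat.add_right_cancel_iff] at h
      have h1 : heapIndex x = heapIndex y := by
        have := congrArg (· / r) h
        simpa [Nat.mul_add_div a.pos, Nat.div_eq_of_lt a.isLt, Nat.div_eq_of_lt b.isLt] using this
      have h2 : a = b := by
        rw [h1] at h
        exact Fin.ext (Nat.add_left_cancel h)
      rw [ih h1, h2]

lemma heapIndex_lt_of_suffix {x y : List (Fin r)} (h : x <:+ y) (hne : x ≠ y) :
    heapIndex x < heapIndex y := by
  obtain ⟨t, rfl⟩ := h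
  induction t with
  | nil => exact absurd rfl hne
  | cons a t ih =>
    have h1 : heapIndex (t ++ x) < heapIndex (a :: t ++ x) := by
      rw [List.cons_append, heapIndex]
      have := Nat.le_mul_of_pos_left (heapIndex (t ++ x)) a.pos
      omega
    rcases eq_or_ne x (t ++ x) with heq | hne'
    · rwa [← heq] at h1
    · exact (ih hne').trans h1

variable (V r) in
/-- With `Q` parts of `M` rounds each, the word of heap index `i` gets the part with index `i`
from the end. -/
lemma exists_schedule : ∃ Q : ℕ, 0 < Q ∧ ∀ M N : ℕ, Q * M ≤ N → Nonempty (Schedule V r M N) := by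
  obtain ⟨Q, hQ⟩ := (Set.finite_range fun x : Word V r => heapIndex x.1).bddAbove
  have hQ' : ∀ x : List (Fin r), x.length < Fintype.card V → heapIndex x ≤ Q :=
    fun x hx => hQ ⟨⟨x, hx⟩, rfl⟩
  refine ⟨Q + 1, Nat.succ_pos _, fun M N hMN => ⟨⟨fun x i => ⟨(Q - heapIndex x) * M + i, ?_⟩,
    fun x y i j hx hy h => ?_, fun x y i j hy hxy hne => ?_⟩⟩⟩
  · have h1 := Nat.mul_le_mul_right M (Nat.sub_le Q (heapIndex x))
    have h2 := i.isLt
    rw [Nat.add_mul] at hMN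
    omega
  · have h' : (Q - heapIndex x) * M + (i : ℕ) = (Q - heapIndex y) * M + j := by
      simpa using congrArg Fin.val h
    have h1 : Q - heapIndex x = Q - heapIndex y := by
      have := congrArg (· / M) h'
      simpa [mul_comm _ M, Nat.mul_add_div i.pos, Nat.div_eq_of_lt i.isLt,
        Nat.div_eq_of_lt j.isLt] using this
    have h2 := hQ' x hx
    have h3 := hQ' y hy
    refine ⟨heapIndex_injective (by omega), ?_⟩
    rw [h1] at h'
    exact Fin.ext (Nat.add_left_cancel h')
  · have h1 := heapIndex_lt_of_suffix hxy hne
    have h2 := hQ' y hy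
    have h3 := i.isLt
    rw [Fin.lt_def]
    change (Q - heapIndex y) * M + i < (Q - heapIndex x) * M + j
    have h4 : Q - heapIndex y + 1 ≤ Q - heapIndex x := by omega
    have h5 := Nat.mul_le_mul_right M h4
    rw [Nat.add_mul] at h5
    omega

variable (F π r) in
/-- The edges of the tree: `(x, a, w)` stands for the edge from the vertex `a` of the round `x` to
the selected vertex of the round that hosts `w` on the path from `a :: x`. -/
def treeEdges : Finset (Word V r × Fin r × V) :=
  Finset.univ.filter fun e => e.1.1.length < (π e.2.2).val ∧
    ∃ u, (π u).val = e.1.1.length ∧ F.Adj u e.2.2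

lemma mem_treeEdges {e : Word V r × Fin r × V} : e ∈ treeEdges F π r ↔
    e.1.1.length < (π e.2.2).val ∧ ∃ u, (π u).val = e.1.1.length ∧ F.Adj u e.2.2 := by
  simp [treeEdges]

lemma suffix_iterate_nextRound (s : List (Fin r) → Fin r) (k : ℕ) (x : List (Fin r)) :
    x <:+ (nextRound s)^[k] x := by
  induction k generalizing x with
  | zero => exact List.suffix_rfl
  | succ k ih => exact (List.suffix_cons _ _).trans (ih (nextRound s x))

lemma iterate_nextRound_congr {s s' : List (Fin r) → Fin r} (k : ℕ) (x : List (Fin r))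
    (h : ∀ z, x <:+ z → z.length < x.length + k → s z = s' z) :
    (nextRound s)^[k] x = (nextRound s')^[k] x := by
  induction k generalizing x with
  | zero => rfl
  | succ k ih =>
    rw [Function.iterate_succ_apply, Function.iterate_succ_apply]
    have : nextRound s x = nextRound s' x := by
      rw [nextRound, nextRound, h x List.suffix_rfl (by omega)]
    rw [this]
    refine ih _ fun z hz hlen => h z ((List.suffix_cons _ _).trans hz) ?_
    rw [nextRound, List.length_cons] at hlen
    omega

lemma hostRound_hostRound {s : List (Fin r) → Fin r} {x : List (Fin r)} {u w : V}
    (hu : x.length ≤ (π u).val) (huw : (π u).val ≤ (π w).val) :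
    hostRound π s (hostRound π s x u) w = hostRound π s x w := by
  rw [hostRound, length_hostRound hu]
  unfold hostRound
  rw [← Function.iterate_add_apply]
  congr 2
  omega

variable [Nonempty V]

/-- The round of the game in which the word `x` is placed. -/
def roundOf (S : Schedule V r M N) (ψ : Word V r → Fin M) (x : List (Fin r)) : Fin N :=
  S.slot x (extend ψ x)

lemma roundOf_eq_roundOf (S : Schedule V r M N) {ψ ψ' : Word V r → Fin M} {x y : List (Fin r)}
    (hx : x.length < Fintype.card V) (hy : y.length < Fintype.card V)
    (h : roundOf S ψ x = roundOf S ψ' y) : x = y ∧ ψ ⟨x, hx⟩ = ψ' ⟨x, hx⟩ := by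
  obtain ⟨rfl, h2⟩ := S.injective _ _ _ _ hx hy h
  rw [extend_of_lt ψ hx, extend_of_lt ψ' hx] at h2
  exact ⟨rfl, h2⟩

/-- The lower end of an edge of the tree, if `c` are the selected indices. -/
def lowerEnd (π : VertexOrdering V) (c : Word V r → Fin r) (e : Word V r × Fin r × V) :
    List (Fin r) := hostRound π (extend c) (e.2.1 :: e.1.1) e.2.2

lemma length_lowerEnd (c : Word V r → Fin r) {e : Word V r × Fin r × V}
    (he : e ∈ treeEdges F π r) : (lowerEnd π c e).length = (π e.2.2).val := by
  refine length_hostRound ?_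
  rw [List.length_cons]
  exact (mem_treeEdges.1 he).1

lemma length_lowerEnd_lt (c : Word V r → Fin r) {e : Word V r × Fin r × V}
    (he : e ∈ treeEdges F π r) : (lowerEnd π c e).length < Fintype.card V := by
  rw [length_lowerEnd c he]
  exact (π e.2.2).isLt

lemma suffix_lowerEnd (π : VertexOrdering V) (c : Word V r → Fin r) (e : Word V r × Fin r × V) :
    e.2.1 :: e.1.1 <:+ lowerEnd π c e := suffix_iterate_nextRound _ _ _

/-- The edge of the hidden graph required by an edge of the tree, with its later vertex first. -/
def placedEdge (π : VertexOrdering V) (S : Schedule V r M N) (ψ : Word V r → Fin M)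
    (c : Word V r → Fin r) (e : Word V r × Fin r × V) : (Fin N × Fin r) × (Fin N × Fin r) :=
  ((roundOf S ψ e.1.1, e.2.1), (roundOf S ψ (lowerEnd π c e), extend c (lowerEnd π c e)))

lemma roundOf_lt_of_suffix (S : Schedule V r M N) (ψ : Word V r → Fin M) {x y : List (Fin r)}
    {a : Fin r} (hy : y.length < Fintype.card V) (h : a :: x <:+ y) :
    roundOf S ψ y < roundOf S ψ x := by
  refine S.lt_of_suffix _ _ _ _ hy ((List.suffix_cons a x).trans h) ?_
  rintro rfl
  have := h.length_le
  simp at this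

lemma placedEdge_descending (S : Schedule V r M N) (ψ : Word V r → Fin M) (c : Word V r → Fin r)
    {e : Word V r × Fin r × V} (he : e ∈ treeEdges F π r) :
    (placedEdge π S ψ c e).2.1 < (placedEdge π S ψ c e).1.1 :=
  roundOf_lt_of_suffix S ψ (length_lowerEnd_lt c he) (suffix_lowerEnd π c e)

/-- A hidden edge required by two placements forces them to agree at both of its ends. -/
lemma eq_of_placedEdge_eq (S : Schedule V r M N) {ψ ψ' : Word V r → Fin M}
    {c c' : Word V r → Fin r} {e e' : Word V r × Fin r × V} (he : e ∈ treeEdges F π r)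
    (he' : e' ∈ treeEdges F π r) (h : placedEdge π S ψ c e = placedEdge π S ψ' c' e') :
    e = e' ∧ ψ e.1 = ψ' e.1 ∧
      ψ ⟨_, length_lowerEnd_lt c he⟩ = ψ' ⟨_, length_lowerEnd_lt c he⟩ := by
  simp only [placedEdge, Prod.mk.injEq] at h
  obtain ⟨⟨h1, h2⟩, h3, -⟩ := h
  obtain ⟨h4, h5⟩ := roundOf_eq_roundOf S e.1.2 e'.1.2 h1
  obtain ⟨h6, h7⟩ := roundOf_eq_roundOf S (length_lowerEnd_lt c he) (length_lowerEnd_lt c' he') h3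
  refine ⟨?_, h5, h7⟩
  have h8 := congrArg List.length h6
  rw [length_lowerEnd c he, length_lowerEnd c' he'] at h8
  exact Prod.ext (Subtype.ext h4) (Prod.ext h2 (π.injective (Fin.ext h8)))

lemma placedEdge_injOn (S : Schedule V r M N) (ψ : Word V r → Fin M) (c : Word V r → Fin r) :
    Set.InjOn (placedEdge π S ψ c) (treeEdges F π r) :=
  fun _ he _ he' h => (eq_of_placedEdge_eq S he he' h).1

/-- Which edge is required by an edge of the tree depends only on the selections in the rounds
strictly below its upper end. -/
lemma placedEdge_congr (S : Schedule V r M N) (ψ : Word V r → Fin M) {c c' : Word V r → Fin r}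
    {e : Word V r × Fin r × V} (he : e ∈ treeEdges F π r)
    (h : ∀ z : Word V r, roundOf S ψ z.1 < roundOf S ψ e.1.1 → c z = c' z) :
    placedEdge π S ψ c e = placedEdge π S ψ c' e := by
  have key : ∀ z, e.2.1 :: e.1.1 <:+ z → z.length < Fintype.card V →
      extend c z = extend c' z := by
    intro z hz hlen
    rw [extend_of_lt c hlen, extend_of_lt c' hlen]
    exact h ⟨z, hlen⟩ (roundOf_lt_of_suffix S ψ hlen hz)
  have hle := (mem_treeEdges.1 he).1
  have hlt := (π e.2.2).isLt
  have hlow : lowerEnd π c e = lowerEnd π c' e := by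
    refine iterate_nextRound_congr _ _ fun z hz hlen => key z hz ?_
    rw [List.length_cons] at hlen
    omega
  unfold placedEdge
  rw [← hlow, key _ (suffix_lowerEnd π c e) (length_lowerEnd_lt c he)]

variable (F) in
/-- The hidden edges required by the placement `ψ` of the tree. -/
def placedEdges (π : VertexOrdering V) (S : Schedule V r M N) (ψ : Word V r → Fin M)
    (c : Word V r → Fin r) : Finset ((Fin N × Fin r) × (Fin N × Fin r)) :=
  (treeEdges F π r).image (placedEdge π S ψ c)

lemma card_placedEdges (S : Schedule V r M N) (ψ : Word V r → Fin M) (c : Word V r → Fin r) :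
    (placedEdges F π S ψ c).card = (treeEdges F π r).card :=
  Finset.card_image_of_injOn (placedEdge_injOn S ψ c)

lemma descending_placedEdges (S : Schedule V r M N) (ψ : Word V r → Fin M)
    (c : Word V r → Fin r) :
    Descending (fun v : Fin N × Fin r => v.1.val) (placedEdges F π S ψ c) := by
  intro f hf
  obtain ⟨e, he, rfl⟩ := Finset.mem_image.1 hf
  exact placedEdge_descending S ψ c he

/-- The rounds of the tree on which two placements agree. -/
def agreement (ψ ψ' : Word V r → Fin M) : Finset (Word V r) :=
  Finset.univ.filter fun x => ψ x = ψ' x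

/-- Two placements share at most the edges that the tree spans on the rounds where they agree. -/
lemma card_placedEdges_inter_le {m : ℝ} (hm : 0 < m) (hr : 1 ≤ r)
    (hmax : ∀ (H₁ : F.Subgraph) (Hs : V → F.Subgraph), IsSubgraphSequence π H₁ Hs →
      densityRatio r π H₁ Hs ≤ m)
    (S : Schedule V r M N) (ψ ψ' : Word V r → Fin M) (c c' : Word V r → Fin r) :
    ((placedEdges F π S ψ c ∩ placedEdges F π S ψ' c').card : ℝ) ≤
      m * (agreement ψ ψ').card := by
  set B : Finset (List (Fin r)) := (agreement ψ ψ').map (Function.Embedding.subtype _) with hB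
  have hmemB : ∀ {x} (hx : x.length < Fintype.card V), ψ ⟨x, hx⟩ = ψ' ⟨x, hx⟩ → x ∈ B := by
    intro x hx h
    rw [hB, Finset.mem_map]
    exact ⟨⟨x, hx⟩, by simpa [agreement] using h, rfl⟩
  have hcard : B.card = (agreement ψ ψ').card := Finset.card_map _
  rw [← hcard]
  refine le_trans ?_ (sum_treeDegree_le hm hr hmax (extend c) B fun x hx => ?_)
  swap
  · obtain ⟨y, -, rfl⟩ := Finset.mem_map.1 hx
    exact y.2
  set J : Finset ((_ : List (Fin r)) × (_ : Fin r) × V) := B.sigma fun x =>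
    Finset.univ.sigma fun a => (hosted π (extend c) B (a :: x)).filter fun w =>
      ∃ u, (π u).val = x.length ∧ F.Adj u w with hJ
  have hJcard : J.card = ∑ x ∈ B, ∑ a, treeDegree F π (extend c) B x a := by
    rw [hJ, Finset.card_sigma]
    exact Finset.sum_congr rfl fun x _ => Finset.card_sigma _ _
  rw [← hJcard]
  have hsub : placedEdges F π S ψ c ∩ placedEdges F π S ψ' c' ⊆ J.image fun e =>
      ((roundOf S ψ e.1, e.2.1),
        (roundOf S ψ (hostRound π (extend c) (e.2.1 :: e.1) e.2.2),
          extend c (hostRound π (extend c) (e.2.1 :: e.1) e.2.2))) := by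
    intro f hf
    obtain ⟨hf1, hf2⟩ := Finset.mem_inter.1 hf
    obtain ⟨e, he, rfl⟩ := Finset.mem_image.1 hf1
    obtain ⟨e', he', heq⟩ := Finset.mem_image.1 hf2
    obtain ⟨-, h1, h2⟩ := eq_of_placedEdge_eq S he he' heq.symm
    refine Finset.mem_image.2 ⟨⟨e.1.1, e.2.1, e.2.2⟩, ?_, rfl⟩
    rw [hJ, Finset.mem_sigma, Finset.mem_sigma, Finset.mem_filter, mem_hosted, List.length_cons]
    exact ⟨hmemB e.1.2 h1, Finset.mem_univ _,
      ⟨(mem_treeEdges.1 he).1, hmemB (length_lowerEnd_lt c he) h2⟩, (mem_treeEdges.1 he).2⟩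
  exact_mod_cast (Finset.card_le_card hsub).trans Finset.card_image_le

/-! ### Successful placements -/

variable (π) in
/-- The indices selected in the rounds in which the tree is placed. -/
def selectedIndices (σ : Strategy N r) (S : Schedule V r M N) (ψ : Word V r → Fin M)
    (G : SimpleGraph (Fin N × Fin r)) : Word V r → Fin r := fun x => choice σ G (roundOf S ψ x.1)

variable (F π) in
/-- The event that all the edges required by the placement `ψ` are present. -/
def successful (σ : Strategy N r) (S : Schedule V r M N) (ψ : Word V r → Fin M) :
    Set (SimpleGraph (Fin N × Fin r)) :=
  {G | ∀ e ∈ placedEdges F π S ψ (selectedIndices σ S ψ G), G.Adj e.1 e.2}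

lemma loses_of_mem_successful {σ : Strategy N r} {S : Schedule V r M N} {ψ : Word V r → Fin M}
    {G : SimpleGraph (Fin N × Fin r)} (h : G ∈ successful F π σ S ψ) : Loses F σ G := by
  set c := selectedIndices σ S ψ G with hc
  set y : V → List (Fin r) := fun u => hostRound π (extend c) [] u with hy
  have hlen : ∀ u, (y u).length = (π u).val := fun u => length_hostRound (Nat.zero_le _)
  have hlt : ∀ u, (y u).length < Fintype.card V := fun u => (hlen u).trans_lt (π u).isLt
  have hsel : ∀ u, extend c (y u) = choice σ G (roundOf S ψ (y u)) :=
    fun u => extend_of_lt c (hlt u)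
  set φ : V → Fin N × Fin r := fun u => (roundOf S ψ (y u), extend c (y u)) with hφ
  have hadj : ∀ u w, F.Adj u w → (π u).val < (π w).val → G.Adj (φ u) (φ w) := by
    intro u w huw hlt'
    set e : Word V r × Fin r × V := (⟨y u, hlt u⟩, extend c (y u), w) with he
    have hmem : e ∈ treeEdges F π r :=
      mem_treeEdges.2 ⟨(hlen u).trans_lt hlt', u, (hlen u).symm, huw⟩
    have hlow : lowerEnd π c e = y w := by
      change hostRound π (extend c) (extend c (y u) :: y u) w = y w
      rw [hostRound_nextRound ((hlen u).trans_lt hlt')]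
      exact hostRound_hostRound (Nat.zero_le _) hlt'.le
    have := h _ (Finset.mem_image_of_mem _ hmem)
    rw [placedEdge, ← hc, hlow] at this
    exact this
  refine ⟨⟨⟨fun u => ⟨φ u, roundOf S ψ (y u), ?_⟩, ?_⟩, ?_⟩⟩
  · rw [hφ]
    simp only [hsel]
    rfl
  · intro u w huw
    rcases lt_or_gt_of_ne (fun h => huw.ne (π.injective (Fin.ext h)) :
      (π u).val ≠ (π w).val) with hlt' | hlt'
    · exact hadj u w huw hlt'
    · exact (hadj w u huw.symm hlt').symm
  · intro u w huw
    have h1 : roundOf S ψ (y u) = roundOf S ψ (y w) := by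
      have := congrArg (fun v => v.1.1) huw
      exact this
    have h2 := congrArg List.length (roundOf_eq_roundOf S (hlt u) (hlt w) h1).1
    rw [hlen, hlen] at h2
    exact π.injective (Fin.ext h2)

lemma choice_congr (σ : Strategy N r) {G G' : SimpleGraph (Fin N × Fin r)} {t : Fin N}
    (h : ∀ a b : Fin N × Fin r, a.1 ≤ t → b.1 ≤ t → (G.Adj a b ↔ G'.Adj a b)) :
    choice σ G t = choice σ G' t := by
  unfold choice
  congr 1
  ext a b
  simp only [SimpleGraph.comap_adj, Function.Embedding.subtype_apply]
  exact h _ _ a.2 b.2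

variable (F π) in
/-- The edges required by the placement `ψ` whose later vertex is revealed in round `t`. -/
def queries (σ : Strategy N r) (S : Schedule V r M N) (ψ : Word V r → Fin M) (t : ℕ)
    (G : SimpleGraph (Fin N × Fin r)) : Finset ((Fin N × Fin r) × (Fin N × Fin r)) :=
  ((treeEdges F π r).filter fun e => (roundOf S ψ e.1.1).val = t).image
    (placedEdge π S ψ (selectedIndices σ S ψ G))

lemma queries_rounds {σ : Strategy N r} {S : Schedule V r M N} {ψ : Word V r → Fin M} {t : ℕ}
    {G : SimpleGraph (Fin N × Fin r)} {f : (Fin N × Fin r) × (Fin N × Fin r)}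
    (hf : f ∈ queries F π σ S ψ t G) : f.1.1.val = t ∧ f.2.1.val < t := by
  obtain ⟨e, he, rfl⟩ := Finset.mem_image.1 hf
  obtain ⟨h1, h2⟩ := Finset.mem_filter.1 he
  have := placedEdge_descending S ψ (selectedIndices σ S ψ G) h1
  rw [Fin.lt_def] at this
  have h3 : (placedEdge π S ψ (selectedIndices σ S ψ G) e).1.1.val = t := h2
  omega

lemma card_queries (σ : Strategy N r) (S : Schedule V r M N) (ψ : Word V r → Fin M) (t : ℕ)
    (G : SimpleGraph (Fin N × Fin r)) : (queries F π σ S ψ t G).card =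
      ((treeEdges F π r).filter fun e => (roundOf S ψ e.1.1).val = t).card :=
  Finset.card_image_of_injOn ((placedEdge_injOn S ψ _).mono (Finset.coe_subset.2 (Finset.filter_subset _ _)))

lemma queries_congr (σ : Strategy N r) (S : Schedule V r M N) (ψ : Word V r → Fin M) {t : ℕ}
    {G G' : SimpleGraph (Fin N × Fin r)}
    (h : ∀ a b : Fin N × Fin r, a.1.val < t → b.1.val < t → (G.Adj a b ↔ G'.Adj a b)) :
    queries F π σ S ψ t G = queries F π σ S ψ t G' := by
  refine Finset.image_congr fun e he => ?_
  rw [Finset.mem_coe, Finset.mem_filter] at he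
  refine placedEdge_congr S ψ he.1 fun z hz => choice_congr σ fun a b ha hb => h a b ?_ ?_
  all_goals
    rw [Fin.lt_def] at hz
    rw [Fin.le_def] at ha hb
    omega

lemma sum_card_queries (S : Schedule V r M N) (ψ : Word V r → Fin M) :
    ∑ t ∈ Finset.range N, ((treeEdges F π r).filter fun e => (roundOf S ψ e.1.1).val = t).card =
      (treeEdges F π r).card :=
  (Finset.card_eq_sum_card_fiberwise fun e _ => by simp).symm

lemma mem_successful_iff {σ : Strategy N r} {S : Schedule V r M N} {ψ : Word V r → Fin M}
    {G : SimpleGraph (Fin N × Fin r)} : G ∈ successful F π σ S ψ ↔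
      ∀ t < N, ∀ e ∈ queries F π σ S ψ t G, G.Adj e.1 e.2 := by
  constructor
  · intro h t _ e he
    exact h e (Finset.image_subset_image (Finset.filter_subset _ _) he)
  · intro h f hf
    obtain ⟨e, he, rfl⟩ := Finset.mem_image.1 hf
    exact h (roundOf S ψ e.1.1).val (Fin.isLt _) _
      (Finset.mem_image_of_mem _ (Finset.mem_filter.2 ⟨he, rfl⟩))

lemma binomialRandom_real_successful (p : unitInterval) (σ : Strategy N r) (S : Schedule V r M N)
    (ψ : Word V r → Fin M) :
    (SimpleGraph.binomialRandom (Fin N × Fin r) p).real (successful F π σ S ψ) =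
      p ^ (treeEdges F π r).card := by
  rw [← sum_card_queries S ψ, ← binomialRandom_real_adaptive p (fun v => v.1.val)
    (queries F π σ S ψ) _ (fun t G e he => queries_rounds he) (card_queries σ S ψ)
    (fun t G G' h => queries_congr σ S ψ h) N]
  congr 1
  ext G
  exact mem_successful_iff

/-- Placements that agree nowhere never query in the same round, hence are independent. -/
lemma binomialRandom_real_successful_inter (p : unitInterval) (σ : Strategy N r)
    (S : Schedule V r M N) {ψ ψ' : Word V r → Fin M} (h : agreement ψ ψ' = ∅) :
    (SimpleGraph.binomialRandom (Fin N × Fin r) p).real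
      (successful F π σ S ψ ∩ successful F π σ S ψ') = (p ^ (treeEdges F π r).card) ^ 2 := by
  have hdisj : ∀ t G, Disjoint (queries F π σ S ψ t G) (queries F π σ S ψ' t G) := by
    intro t G
    rw [Finset.disjoint_left]
    intro f hf hf'
    obtain ⟨e, he, rfl⟩ := Finset.mem_image.1 hf
    obtain ⟨e', he', heq⟩ := Finset.mem_image.1 hf'
    have h1 := (eq_of_placedEdge_eq S (Finset.mem_filter.1 he).1 (Finset.mem_filter.1 he').1
      heq.symm).2.1
    have : e.1 ∈ agreement ψ ψ' := by simpa [agreement] using h1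
    rw [h] at this
    exact Finset.notMem_empty _ this
  -- Round by round, the two placements together query the edges of one of them at most.
  have hexp : (treeEdges F π r).card * 2 = ∑ t ∈ Finset.range N,
      (((treeEdges F π r).filter fun e => (roundOf S ψ e.1.1).val = t).card +
        ((treeEdges F π r).filter fun e => (roundOf S ψ' e.1.1).val = t).card) := by
    rw [Finset.sum_add_distrib, sum_card_queries, sum_card_queries, mul_two]
  rw [← pow_mul, hexp, ← binomialRandom_real_adaptive p (fun v => v.1.val)
    (fun t G => queries F π σ S ψ t G ∪ queries F π σ S ψ' t G) _
    (fun t G e he => (Finset.mem_union.1 he).elim queries_rounds queries_rounds)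
    (fun t G => by rw [Finset.card_union_of_disjoint (hdisj t G), card_queries, card_queries])
    (fun t G G' h => by rw [queries_congr σ S ψ h, queries_congr σ S ψ' h]) N]
  congr 1
  ext G
  simp only [Set.mem_inter_iff, mem_successful_iff, Set.mem_ofPred_eq, Finset.mem_union]
  constructor
  · rintro ⟨h1, h2⟩ t ht e (he | he)
    · exact h1 t ht e he
    · exact h2 t ht e he
  · exact fun h => ⟨fun t ht e he => h t ht e (Or.inl he), fun t ht e he => h t ht e (Or.inr he)⟩

/-- The union bound over the selected indices, for placements that may overlap. -/
lemma binomialRandom_real_successful_inter_le {m : ℝ} (hm : 0 < m) (hr : 1 ≤ r)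
    (hmax : ∀ (H₁ : F.Subgraph) (Hs : V → F.Subgraph), IsSubgraphSequence π H₁ Hs →
      densityRatio r π H₁ Hs ≤ m)
    {p : unitInterval} (hp : 0 < (p : ℝ)) (σ : Strategy N r) (S : Schedule V r M N)
    (ψ ψ' : Word V r → Fin M) :
    (SimpleGraph.binomialRandom (Fin N × Fin r) p).real
      (successful F π σ S ψ ∩ successful F π σ S ψ') ≤
      (r : ℝ) ^ (2 * Fintype.card (Word V r)) * ((p ^ (treeEdges F π r).card) ^ 2 *
        (((p : ℝ) ^ m)⁻¹) ^ (agreement ψ ψ').card) := by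
  have hcover : successful F π σ S ψ ∩ successful F π σ S ψ' ⊆
      ⋃ cc ∈ (Finset.univ : Finset ((Word V r → Fin r) × (Word V r → Fin r))),
        {G : SimpleGraph (Fin N × Fin r) | ∀ e ∈ placedEdges F π S ψ cc.1 ∪
          placedEdges F π S ψ' cc.2, G.Adj e.1 e.2} := by
    rintro G ⟨h1, h2⟩
    simp only [Set.mem_iUnion]
    refine ⟨(selectedIndices σ S ψ G, selectedIndices σ S ψ' G), Finset.mem_univ _, ?_⟩
    intro e he
    rcases Finset.mem_union.1 he with he | he
    · exact h1 e he
    · exact h2 e he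
  have hbound : ∀ cc ∈ (Finset.univ : Finset ((Word V r → Fin r) × (Word V r → Fin r))),
      (SimpleGraph.binomialRandom (Fin N × Fin r) p).real
        {G : SimpleGraph (Fin N × Fin r) | ∀ e ∈ placedEdges F π S ψ cc.1 ∪
          placedEdges F π S ψ' cc.2, G.Adj e.1 e.2} ≤
      (p ^ (treeEdges F π r).card) ^ 2 * (((p : ℝ) ^ m)⁻¹) ^ (agreement ψ ψ').card := by
    rintro ⟨c, c'⟩ -
    have hdesc : Descending (fun v : Fin N × Fin r => v.1.val)
        (placedEdges F π S ψ c ∪ placedEdges F π S ψ' c') := by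
      intro e he
      rcases Finset.mem_union.1 he with he | he
      · exact descending_placedEdges S ψ c e he
      · exact descending_placedEdges S ψ' c' e he
    rw [binomialRandom_real_pairs p hdesc]
    have h1 := Finset.card_union_add_card_inter (placedEdges F π S ψ c) (placedEdges F π S ψ' c')
    rw [card_placedEdges, card_placedEdges] at h1
    have h2 := card_placedEdges_inter_le hm hr hmax S ψ ψ' c c'
    set k := (placedEdges F π S ψ c ∩ placedEdges F π S ψ' c').card
    rw [inv_pow, ← div_eq_mul_inv, le_div_iff₀ (pow_pos (Real.rpow_pos_of_pos hp _) _),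
      ← pow_mul, mul_two, ← h1, pow_add]
    refine mul_le_mul_of_nonneg_left ?_ (pow_nonneg hp.le _)
    rw [← Real.rpow_mul_natCast hp.le, ← Real.rpow_natCast]
    exact Real.rpow_le_rpow_of_exponent_ge hp p.2.2 h2
  refine (MeasureTheory.measureReal_mono hcover (MeasureTheory.measure_ne_top _ _)).trans ?_
  refine (MeasureTheory.measureReal_biUnion_finset_le _ _).trans ?_
  refine (Finset.sum_le_card_nsmul _ _ _ hbound).trans_eq ?_
  rw [nsmul_eq_mul]
  congr 1
  rw [Finset.card_univ, Fintype.card_prod, Fintype.card_fun, Fintype.card_fin, two_mul, pow_add]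
  push_cast
  rfl

end Embedding

/-! ### The second moment and losing above the threshold -/

section Losing

open Classical

variable {V : Type*} [Fintype V] {F : SimpleGraph V} {π : VertexOrdering V} {r M N : ℕ}

lemma sum_pow_card_agreement_le (ψ : Word V r → Fin M) :
    ∑ ψ' : Word V r → Fin M, (M : ℝ) ^ (agreement ψ ψ').card ≤
      (2 * M : ℝ) ^ Fintype.card (Word V r) := by
  have h1 : ∀ ψ' : Word V r → Fin M, (M : ℝ) ^ (agreement ψ ψ').card =
      ∏ x, if ψ x = ψ' x then (M : ℝ) else 1 := by
    intro ψ'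
    rw [Finset.prod_ite, Finset.prod_const_one, mul_one, Finset.prod_const]
    rfl
  simp_rw [h1]
  rw [← Fintype.prod_sum fun x j => if ψ x = j then (M : ℝ) else 1]
  rw [← Finset.card_univ, ← Finset.prod_const]
  refine Finset.prod_le_prod (fun x _ => Finset.sum_nonneg fun j _ => ?_) fun x _ => ?_
  · split_ifs
    · exact Nat.cast_nonneg _
    · exact zero_le_one
  calc ∑ j, (if ψ x = j then (M : ℝ) else 1) ≤ ∑ j, ((if ψ x = j then (M : ℝ) else 0) + 1) := by
        refine Finset.sum_le_sum fun j _ => ?_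
        split_ifs <;> simp
    _ = 2 * M := by
        rw [Finset.sum_add_distrib, Finset.sum_ite_eq, if_pos (Finset.mem_univ _)]
        simp [two_mul]

/-- The second moment method, applied to the number of successful placements of the tree. -/
lemma binomialRandom_real_not_loses_le {m : ℝ} (hm : 0 < m) (hr : 1 ≤ r) [Nonempty V]
    (hmax : ∀ (H₁ : F.Subgraph) (Hs : V → F.Subgraph), IsSubgraphSequence π H₁ Hs →
      densityRatio r π H₁ Hs ≤ m)
    {p : unitInterval} (hp : 0 < (p : ℝ)) (hM : 1 ≤ M * (p : ℝ) ^ m) (σ : Strategy N r)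
    (S : Schedule V r M N) :
    (SimpleGraph.binomialRandom (Fin N × Fin r) p).real {G | ¬ Loses F σ G} ≤
      (r : ℝ) ^ (2 * Fintype.card (Word V r)) * 2 ^ Fintype.card (Word V r) /
        (M * (p : ℝ) ^ m) := by
  set k := Fintype.card (Word V r) with hk
  set q : ℝ := p ^ (treeEdges F π r).card with hq
  set y : ℝ := M * (p : ℝ) ^ m with hy
  have hpm : 0 < (p : ℝ) ^ m := Real.rpow_pos_of_pos hp m
  have hM0 : (0 : ℝ) < M := by
    by_contra hcon
    have : (M : ℝ) = 0 := le_antisymm (not_lt.1 hcon) (Nat.cast_nonneg _)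
    rw [hy, this, zero_mul] at hM
    linarith
  have hq0 : 0 < q := pow_pos hp _
  have hy0 : 0 < y := by linarith
  have hmean : ∑ ψ : Word V r → Fin M,
      (SimpleGraph.binomialRandom (Fin N × Fin r) p).real (successful F π σ S ψ) =
      (M : ℝ) ^ k * q := by
    simp_rw [binomialRandom_real_successful]
    rw [Finset.sum_const, Finset.card_univ, Fintype.card_fun, Fintype.card_fin, nsmul_eq_mul]
    push_cast
    rfl
  have hpair : ∀ ψ ψ' : Word V r → Fin M,
      (SimpleGraph.binomialRandom (Fin N × Fin r) p).real
        (successful F π σ S ψ ∩ successful F π σ S ψ') ≤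
      q ^ 2 + (r : ℝ) ^ (2 * k) * q ^ 2 * y⁻¹ * (M : ℝ) ^ (agreement ψ ψ').card := by
    intro ψ ψ'
    rcases (agreement ψ ψ').eq_empty_or_nonempty with h | h
    · rw [binomialRandom_real_successful_inter p σ S h]
      exact le_add_of_nonneg_right (by positivity)
    · refine (binomialRandom_real_successful_inter_le hm hr hmax hp σ S ψ ψ').trans ?_
      -- Each round of agreement divides the number of pairs by `M`, and multiplies the bound on the
      -- probability by `1 / p ^ m`.
      have h1 : (((p : ℝ) ^ m)⁻¹) ^ (agreement ψ ψ').card =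
          (M : ℝ) ^ (agreement ψ ψ').card * (y⁻¹) ^ (agreement ψ ψ').card := by
        rw [← mul_pow]
        congr 1
        rw [hy]
        field_simp
      have h2 : (y⁻¹) ^ (agreement ψ ψ').card ≤ y⁻¹ :=
        pow_le_of_le_one (inv_nonneg.2 hy0.le) (inv_le_one_of_one_le₀ hM) h.card_pos.ne'
      rw [h1]
      calc (r : ℝ) ^ (2 * k) * (q ^ 2 *
            ((M : ℝ) ^ (agreement ψ ψ').card * (y⁻¹) ^ (agreement ψ ψ').card))
          = (r : ℝ) ^ (2 * k) * q ^ 2 * (M : ℝ) ^ (agreement ψ ψ').card *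
            (y⁻¹) ^ (agreement ψ ψ').card := by ring
        _ ≤ (r : ℝ) ^ (2 * k) * q ^ 2 * (M : ℝ) ^ (agreement ψ ψ').card * y⁻¹ :=
            mul_le_mul_of_nonneg_left h2 (by positivity)
        _ = (r : ℝ) ^ (2 * k) * q ^ 2 * y⁻¹ * (M : ℝ) ^ (agreement ψ ψ').card := by ring
        _ ≤ _ := le_add_of_nonneg_left (by positivity)
  have hsum : ∑ ψ : Word V r → Fin M, ∑ ψ' : Word V r → Fin M,
      (SimpleGraph.binomialRandom (Fin N × Fin r) p).real
        (successful F π σ S ψ ∩ successful F π σ S ψ') ≤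
      ((M : ℝ) ^ k * q) ^ 2 + ((M : ℝ) ^ k * q) ^ 2 * ((r : ℝ) ^ (2 * k) * 2 ^ k / y) := by
    have hcard : ((Finset.univ : Finset (Word V r → Fin M)).card : ℝ) = (M : ℝ) ^ k := by
      rw [Finset.card_univ, Fintype.card_fun, Fintype.card_fin]
      push_cast
      rfl
    have h1 : ∀ ψ : Word V r → Fin M, ∑ ψ' : Word V r → Fin M,
        (SimpleGraph.binomialRandom (Fin N × Fin r) p).real
          (successful F π σ S ψ ∩ successful F π σ S ψ') ≤
        (M : ℝ) ^ k * q ^ 2 + (r : ℝ) ^ (2 * k) * q ^ 2 * y⁻¹ * (2 * M : ℝ) ^ k := by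
      intro ψ
      refine (Finset.sum_le_sum fun ψ' _ => hpair ψ ψ').trans ?_
      rw [Finset.sum_add_distrib, Finset.sum_const, nsmul_eq_mul, hcard, ← Finset.mul_sum]
      exact add_le_add le_rfl
        (mul_le_mul_of_nonneg_left (sum_pow_card_agreement_le ψ) (by positivity))
    refine (Finset.sum_le_sum fun ψ _ => h1 ψ).trans_eq ?_
    rw [Finset.sum_const, nsmul_eq_mul, hcard, mul_pow 2 (M : ℝ) k]
    ring
  have hcheb := binomialRandom_real_forall_not_le p (successful F π σ S) hmean
  have hmono : (SimpleGraph.binomialRandom (Fin N × Fin r) p).real {G | ¬ Loses F σ G} ≤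
      (SimpleGraph.binomialRandom (Fin N × Fin r) p).real
        {G | ∀ ψ : Word V r → Fin M, G ∉ successful F π σ S ψ} :=
    MeasureTheory.measureReal_mono (fun G hG ψ hψ => hG (loses_of_mem_successful hψ))
      (MeasureTheory.measure_ne_top _ _)
  refine hmono.trans ?_
  have hμ : 0 < ((M : ℝ) ^ k * q) ^ 2 := by positivity
  refine le_of_mul_le_mul_left (hcheb.trans ?_) hμ
  linarith

lemma tendsto_mul_rpow_atTop {m : ℝ} (hm : 0 < m) (hr : 0 < r) {p : ℕ → unitInterval}
    (hp : (fun N : ℕ => ((N * r : ℕ) : ℝ) ^ (-1 / m)) =o[atTop]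
      (fun N : ℕ => (p (N * r) : ℝ))) :
    Tendsto (fun N : ℕ => (N : ℝ) * (p (N * r) : ℝ) ^ m) atTop atTop := by
  refine tendsto_atTop.2 fun A => ?_
  set A' : ℝ := max A 1 with hA'
  have hA'0 : 0 < A' := lt_max_of_lt_right one_pos
  set c : ℝ := (A' * r) ^ (-1 / m) with hc
  have hrpos : (0 : ℝ) < r := by exact_mod_cast hr
  have hc0 : 0 < c := Real.rpow_pos_of_pos (mul_pos hA'0 hrpos) _
  filter_upwards [hp.bound hc0, eventually_ge_atTop 1] with N hN hN1
  have hNpos : (0 : ℝ) < N := by exact_mod_cast hN1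
  rw [Real.norm_of_nonneg (Real.rpow_nonneg (Nat.cast_nonneg _) _),
    Real.norm_of_nonneg (p _).2.1] at hN
  have h1 := Real.rpow_le_rpow (Real.rpow_nonneg (Nat.cast_nonneg _) _) hN hm.le
  rw [Real.mul_rpow hc0.le (p _).2.1, hc, ← Real.rpow_mul (Nat.cast_nonneg _),
    ← Real.rpow_mul (mul_pos hA'0 hrpos).le, div_mul_cancel₀ _ hm.ne', Real.rpow_neg_one,
    Real.rpow_neg_one, ← div_eq_inv_mul, le_div_iff₀ (mul_pos hA'0 hrpos)] at h1
  push_cast at h1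
  have h2 := mul_le_mul_of_nonneg_left h1 hNpos.le
  have h3 : (N : ℝ) * (((N : ℝ) * r)⁻¹ * (A' * r)) = A' := by field_simp
  rw [h3] at h2
  exact (le_max_left _ _).trans h2

/-- Above the threshold, every strategy a.a.s. loses. -/
theorem tendsto_probLoses (hF : F ≠ ⊥) (hr : 0 < r) {p : ℕ → unitInterval}
    (hp : (fun N : ℕ => ((N * r : ℕ) : ℝ) ^ (-1 / mStar r F)) =o[atTop]
      (fun N : ℕ => (p (N * r) : ℝ))) (σ : (N : ℕ) → Strategy N r) :
    Tendsto (fun N : ℕ => probLoses F (σ N) (p (N * r))) atTop (𝓝 1) := by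
  have hm := mStar_pos hr hF
  have hV : Nonempty V := by
    by_contra hcon
    rw [not_nonempty_iff] at hcon
    exact hF (Subsingleton.elim _ _)
  obtain ⟨π, hmax⟩ := exists_forall_densityRatio_le_mStar r F
  obtain ⟨Q, hQ, hsched⟩ := exists_schedule V r
  have hlim := tendsto_mul_rpow_atTop hm hr hp
  have hQ' : (0 : ℝ) < Q := by exact_mod_cast hQ
  have hlimM : Tendsto (fun N : ℕ => ((N / Q : ℕ) : ℝ) * (p (N * r) : ℝ) ^ mStar r F)
      atTop atTop := by
    refine tendsto_atTop_mono' _ ?_ (hlim.atTop_div_const (by positivity : (0 : ℝ) < 2 * Q))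
    filter_upwards [eventually_ge_atTop Q] with N hN
    rw [mul_div_right_comm]
    refine mul_le_mul_of_nonneg_right ?_ (Real.rpow_nonneg (p _).2.1 _)
    rw [div_le_iff₀ (by positivity)]
    have h1 := Nat.div_add_mod N Q
    have h2 := Nat.mod_lt N hQ
    have h3 : 1 ≤ N / Q := (Nat.one_le_div_iff hQ).2 hN
    have h4 : N ≤ N / Q * (2 * Q) := by nlinarith
    exact_mod_cast h4
  have hreal : Tendsto (fun N : ℕ => (probLoses F (σ N) (p (N * r))).toReal) atTop (𝓝 1) := by
    set C : ℝ := (r : ℝ) ^ (2 * Fintype.card (Word V r)) * 2 ^ Fintype.card (Word V r)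
    have hlow : Tendsto (fun N : ℕ => 1 - C / (((N / Q : ℕ) : ℝ) *
        (p (N * r) : ℝ) ^ mStar r F)) atTop (𝓝 1) := by
      simpa using (tendsto_const_nhds (x := (1 : ℝ))).sub
        ((tendsto_const_nhds (x := C)).div_atTop hlimM)
    refine tendsto_of_tendsto_of_tendsto_of_le_of_le' hlow tendsto_const_nhds ?_
      (Eventually.of_forall fun N => MeasureTheory.measureReal_le_one)
    filter_upwards [hlimM.eventually_ge_atTop 1] with N hN
    have hp0 : 0 < (p (N * r) : ℝ) := by
      rcases (p (N * r)).2.1.eq_or_lt with h | h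
      · rw [← h, Real.zero_rpow hm.ne', mul_zero] at hN
        linarith
      · exact h
    obtain ⟨S⟩ := hsched (N / Q) N (Nat.mul_div_le N Q)
    have h1 := binomialRandom_real_not_loses_le hm hr hmax hp0 hN (σ N) S
    have h2 : (SimpleGraph.binomialRandom (Fin N × Fin r) (p (N * r))).real Set.univ ≤
        (SimpleGraph.binomialRandom (Fin N × Fin r) (p (N * r))).real {G | Loses F (σ N) G} +
        (SimpleGraph.binomialRandom (Fin N × Fin r) (p (N * r))).real {G | ¬ Loses F (σ N) G} :=
      (MeasureTheory.measureReal_mono fun G _ => Classical.em (Loses F (σ N) G)).trans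
        (MeasureTheory.measureReal_union_le _ _)
    rw [MeasureTheory.measureReal_def, MeasureTheory.measure_univ, ENNReal.toReal_one] at h2
    have h3 : (probLoses F (σ N) (p (N * r))).toReal =
      (SimpleGraph.binomialRandom (Fin N × Fin r) (p (N * r))).real {G | Loses F (σ N) G} := rfl
    rw [h3]
    linarith
  have := ENNReal.tendsto_ofReal hreal
  rw [ENNReal.ofReal_one] at this
  exact this.congr fun N => ENNReal.ofReal_toReal (MeasureTheory.measure_ne_top _ _)

end Losing

end VertexAchlioptas

end

theorem mainTheorem3 {V : Type*} [Fintype V] (F : SimpleGraph V) (hF : F ≠ ⊥)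
    (r : ℕ) (hr : 2 ≤ r) :
    VertexAchlioptas.IsThreshold F r
        (fun n : ℕ => (n : ℝ) ^ (-1 / VertexAchlioptas.mStar r F)) ∧
      ∀ p : ℕ → unitInterval,
        (fun N : ℕ => ((N * r : ℕ) : ℝ) ^ (-1 / VertexAchlioptas.mStar r F)) =o[atTop]
            (fun N : ℕ => (p (N * r) : ℝ)) →
        ∀ σ : (N : ℕ) → VertexAchlioptas.Strategy N r,
          Tendsto (fun N : ℕ => VertexAchlioptas.probLoses F (σ N) (p (N * r))) atTop (𝓝 1) := by
  have hr0 : 0 < r := by omega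
  exact ⟨⟨fun _ hp => VertexAchlioptas.exists_strategy_tendsto_probSurvives hF hr0 hp,
    fun _ hp σ => VertexAchlioptas.tendsto_probLoses hF hr0 hp σ⟩,
    fun _ hp σ => VertexAchlioptas.tendsto_probLoses hF hr0 hp σ⟩
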